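/- Let $\mathbb D$ be the open unit disc and let $Bel(\mathbb D)=L^\infty(\mathbb D,\mathbb C)$ be the Banach space of Beltrami differentials on $\mathbb D$. A degenerating sequence is a sequence $(\varphi_n)$ of integrable holomorphic functions on $\mathbb D$ with $\iint_{\mathbb D}|\varphi_n|\,dx\,dy=1$ for all $n$ that converges to $0$ uniformly on compact subsets of $\mathbb D$. For $\mu\in Bel(\mathbb D)$ put $$\|\mu\|_{AZ}=\sup_{(\varphi_n)}\ \limsup_{n\to\infty}\Bigl|\iint_{\mathbb D}\mu\,\varphi_n\,dx\,dy\Bigr|,$$ the supremum being taken over all degenerating sequences. Let $AZ(\mathbb D)$, the tangent space to the universal asymptotic Teichmüller space $AT(\mathbb D)$ at its basepoint, be the quotient of $Bel(\mathbb D)$ by the subspace $\{\mu:\|\mu\|_{AZ}=0\}$, with the norm induced by $\|\cdot\|_{AZ}$ and the corresponding metric; denote the class of $\mu$ by $[[\mu]]_{AZ}$. For $\nu\in Bel(\mathbb D)$ let $b^*(\nu)$ be the infimum over compact $E\subset\mathbb D$ of the essential supremum of $|\nu|$ on $\mathbb D\setminus E$, and for $p\in\partial\mathbb D$ let $b^*_p(\nu)$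 be the infimum over open $U\subset\mathbb C$ containing $p$ of the essential supremum of $|\nu|$ on $U\cap\mathbb D$. Let $b([[\mu]]_{AZ})$ and $b_p([[\mu]]_{AZ})$ be the infima of $b^*(\nu)$ and of $b^*_p(\nu)$, respectively, over all $\nu\in[[\mu]]_{AZ}$. The point $[[\mu]]_{AZ}$ is called substantial if $b_p([[\mu]]_{AZ})=b([[\mu]]_{AZ})$ for every $p\in\partial\mathbb D$, and non-substantial otherwise. A geodesic joining $x$ and $y$ in a metric space is the image of an isometric (distance-preserving) map of a compact interval $[a,b]\subset\mathbb R$, $a<b$, that sends the endpoints of the interval to $x$ and $y$. **Theorem.** If $[[\mu]]_{AZ}$ is a non-substantial point of $AZ(\mathbb D)$, then there are infinitely many geodesics (as subsets of $AZ(\mathbb D)$) joining $[[\mu]]_{AZ}$ with the basepoint $0=[[0]]_{AZ}$. -/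

import Mathlib

open MeasureTheory Filter Topology
open scoped ENNReal

noncomputable section

namespace AsymptoticTangent

/-- The open unit disc `𝔻` in the complex plane. -/
def disc : Set ℂ := Metric.ball (0 : ℂ) 1

/-- The Banach space `Bel(𝔻)` of (almost everywhere classes of) essentially bounded measurable
Beltrami differentials on `𝔻`. -/
abbrev Bel : Type := Lp ℂ ∞ ((volume : Measure ℂ).restrict disc)

/-- `φ` lies in the unit sphere `Q¹(𝔻)` of the space of integrable holomorphic quadratic
differentials on `𝔻`. -/
structure IsUnitQuadDiff (φ : ℂ → ℂ) : Prop where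
  holo : DifferentiableOn ℂ φ disc
  integrable : IntegrableOn φ disc volume
  norm_eq_one : ∫ z in disc, ‖φ z‖ = 1

/-- A degenerating sequence: a sequence in `Q¹(𝔻)` that converges to `0` uniformly on compact
subsets of `𝔻`. -/
structure IsDegenerating (φ : ℕ → ℂ → ℂ) : Prop where
  unit : ∀ n, IsUnitQuadDiff (φ n)
  tendsto : ∀ K : Set ℂ, IsCompact K → K ⊆ disc → TendstoUniformlyOn φ (fun _ => 0) atTop K

/-- The pairing `∬_𝔻 μ φ dx dy`. -/
def pairing (μ : Bel) (φ : ℂ → ℂ) : ℂ := ∫ z in disc, μ z * φ z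

/-- The quantity `sup limsup_n |∬_𝔻 μ φ_n dx dy|`, the supremum being taken over all degenerating
sequences. -/
def degSup (μ : Bel) : ℝ :=
  ⨆ φ : {φ : ℕ → ℂ → ℂ // IsDegenerating φ}, limsup (fun n => ‖pairing μ (φ.1 n)‖) atTop

theorem ae_norm_le (μ : Bel) : ∀ᵐ z ∂((volume : Measure ℂ).restrict disc), ‖μ z‖ ≤ ‖μ‖ := by
  have h := ae_le_eLpNormEssSup (f := μ) (μ := (volume : Measure ℂ).restrict disc)
  filter_upwards [h] with z hz
  rw [Lp.norm_def, eLpNorm_exponent_top, ← toReal_enorm]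
  refine ENNReal.toReal_mono ?_ hz
  have := Lp.eLpNorm_ne_top μ
  rwa [eLpNorm_exponent_top] at this

theorem integrable_mul (μ : Bel) {φ : ℂ → ℂ} (hφ : IsUnitQuadDiff φ) :
    Integrable (fun z => μ z * φ z) ((volume : Measure ℂ).restrict disc) :=
  Integrable.bdd_mul hφ.integrable (Lp.aestronglyMeasurable μ) (ae_norm_le μ)

theorem norm_pairing_le (μ : Bel) {φ : ℂ → ℂ} (hφ : IsUnitQuadDiff φ) :
    ‖pairing μ φ‖ ≤ ‖μ‖ := by
  calc ‖pairing μ φ‖ ≤ ∫ z in disc, ‖μ‖ * ‖φ z‖ := by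
        refine norm_integral_le_of_norm_le (hφ.integrable.norm.const_mul _) ?_
        filter_upwards [ae_norm_le μ] with z hz
        rw [norm_mul]
        gcongr
    _ = ‖μ‖ := by rw [integral_const_mul, hφ.norm_eq_one, mul_one]

theorem pairing_add (μ ν : Bel) {φ : ℂ → ℂ} (hφ : IsUnitQuadDiff φ) :
    pairing (μ + ν) φ = pairing μ φ + pairing ν φ := by
  unfold pairing
  rw [← integral_add (integrable_mul μ hφ) (integrable_mul ν hφ)]
  refine integral_congr_ae ?_
  filter_upwards [Lp.coeFn_add μ ν] with z hz
  rw [hz, Pi.add_apply, add_mul]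

theorem pairing_smul (c : ℂ) (μ : Bel) (φ : ℂ → ℂ) :
    pairing (c • μ) φ = c * pairing μ φ := by
  unfold pairing
  rw [← integral_const_mul]
  refine integral_congr_ae ?_
  filter_upwards [Lp.coeFn_smul c μ] with z hz
  rw [hz, Pi.smul_apply, smul_eq_mul, mul_assoc]

theorem isBoundedUnder_le (μ : Bel) {φ : ℕ → ℂ → ℂ} (hφ : IsDegenerating φ) :
    IsBoundedUnder (· ≤ ·) atTop (fun n => ‖pairing μ (φ n)‖) :=
  isBoundedUnder_of ⟨‖μ‖, fun n => norm_pairing_le μ (hφ.unit n)⟩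

theorem isBoundedUnder_ge (μ : Bel) (φ : ℕ → ℂ → ℂ) :
    IsBoundedUnder (· ≥ ·) atTop (fun n => ‖pairing μ (φ n)‖) :=
  isBoundedUnder_of ⟨0, fun _ => norm_nonneg _⟩

theorem limsup_le_norm (μ : Bel) {φ : ℕ → ℂ → ℂ} (hφ : IsDegenerating φ) :
    limsup (fun n => ‖pairing μ (φ n)‖) atTop ≤ ‖μ‖ :=
  limsup_le_of_le (isBoundedUnder_ge μ φ).isCoboundedUnder_le
    (Eventually.of_forall fun n => norm_pairing_le μ (hφ.unit n))

theorem limsup_nonneg (μ : Bel) {φ : ℕ → ℂ → ℂ} (hφ : IsDegenerating φ) :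
    0 ≤ limsup (fun n => ‖pairing μ (φ n)‖) atTop :=
  le_limsup_of_frequently_le (Frequently.of_forall fun _ => norm_nonneg _)
    (isBoundedUnder_le μ hφ)

theorem bddAbove_limsup (μ : Bel) :
    BddAbove (Set.range fun φ : {φ : ℕ → ℂ → ℂ // IsDegenerating φ} =>
      limsup (fun n => ‖pairing μ (φ.1 n)‖) atTop) :=
  ⟨‖μ‖, by rintro _ ⟨φ, rfl⟩; exact limsup_le_norm μ φ.2⟩

theorem degSup_nonneg (μ : Bel) : 0 ≤ degSup μ :=
  Real.iSup_nonneg fun φ => limsup_nonneg μ φ.2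

theorem degSup_add_le (μ ν : Bel) : degSup (μ + ν) ≤ degSup μ + degSup ν := by
  refine Real.iSup_le (fun φ => ?_) (add_nonneg (degSup_nonneg μ) (degSup_nonneg ν))
  calc limsup (fun n => ‖pairing (μ + ν) (φ.1 n)‖) atTop
      ≤ limsup ((fun n => ‖pairing μ (φ.1 n)‖) + fun n => ‖pairing ν (φ.1 n)‖) atTop := by
        refine limsup_le_limsup (Eventually.of_forall fun n => ?_)
          (isBoundedUnder_ge (μ + ν) φ.1).isCoboundedUnder_le
          (isBoundedUnder_le_add (isBoundedUnder_le μ φ.2) (isBoundedUnder_le ν φ.2))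
        simp only [Pi.add_apply, pairing_add μ ν (φ.2.unit n)]
        exact norm_add_le _ _
    _ ≤ limsup (fun n => ‖pairing μ (φ.1 n)‖) atTop
        + limsup (fun n => ‖pairing ν (φ.1 n)‖) atTop :=
        limsup_add_le (isBoundedUnder_ge μ φ.1) (isBoundedUnder_le μ φ.2)
          (isBoundedUnder_ge ν φ.1).isCoboundedUnder_le (isBoundedUnder_le ν φ.2)
    _ ≤ degSup μ + degSup ν :=
        add_le_add (le_ciSup (bddAbove_limsup μ) φ) (le_ciSup (bddAbove_limsup ν) φ)

theorem degSup_zero : degSup 0 = 0 :=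
  le_antisymm
    (Real.iSup_le (fun φ => (limsup_le_norm 0 φ.2).trans_eq norm_zero) le_rfl)
    (degSup_nonneg 0)

theorem degSup_smul_le (c : ℂ) (μ : Bel) : degSup (c • μ) ≤ ‖c‖ * degSup μ := by
  refine Real.iSup_le (fun φ => ?_) (mul_nonneg (norm_nonneg c) (degSup_nonneg μ))
  have hmono : Monotone fun x : ℝ => ‖c‖ * x :=
    fun x y h => mul_le_mul_of_nonneg_left h (norm_nonneg c)
  have h := hmono.map_limsup_of_continuousAt (F := atTop)
    (fun n => ‖pairing μ (φ.1 n)‖) (by fun_prop) (isBoundedUnder_le μ φ.2)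
    (isBoundedUnder_ge μ φ.1).isCoboundedUnder_le
  have h2 : (fun n => ‖pairing (c • μ) (φ.1 n)‖)
      = (fun x : ℝ => ‖c‖ * x) ∘ fun n => ‖pairing μ (φ.1 n)‖ := by
    funext n
    simp [pairing_smul]
  rw [h2, ← h]
  exact hmono (le_ciSup (bddAbove_limsup μ) φ)

/-- The degenerating quadratic-differential seminorm on `Bel(𝔻)`. -/
def degSeminorm : Seminorm ℂ Bel :=
  Seminorm.ofSMulLE degSup degSup_zero degSup_add_le degSup_smul_le

/-- The subspace of Beltrami differentials that are infinitesimally asymptotically equivalent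
to `0`. -/
def nullSpace : Submodule ℂ Bel where
  carrier := {μ | degSup μ = 0}
  add_mem' {μ ν} hμ hν := by
    refine le_antisymm ((degSup_add_le μ ν).trans ?_) (degSup_nonneg _)
    rw [Set.mem_ofPred_eq] at hμ hν
    rw [hμ, hν, add_zero]
  zero_mem' := degSup_zero
  smul_mem' c μ hμ := by
    refine le_antisymm ((degSup_smul_le c μ).trans ?_) (degSup_nonneg _)
    rw [Set.mem_ofPred_eq] at hμ
    rw [hμ, mul_zero]

/-- The tangent space `AZ(𝔻)` at the basepoint of the universal asymptotic Teichmüller space: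
`Bel(𝔻)` modulo infinitesimal asymptotic equivalence. -/
def AZ : Type := Bel ⧸ nullSpace

instance : AddCommGroup AZ := inferInstanceAs (AddCommGroup (Bel ⧸ nullSpace))

instance : Module ℂ AZ := inferInstanceAs (Module ℂ (Bel ⧸ nullSpace))

/-- The class `[[μ]]_AZ` of `μ`. -/
def AZ.mk : Bel →ₗ[ℂ] AZ := nullSpace.mkQ

theorem AZ.mk_surjective : Function.Surjective AZ.mk := nullSpace.mkQ_surjective

theorem AZ.mk_eq_mk_iff (μ ν : Bel) : AZ.mk μ = AZ.mk ν ↔ degSup (μ - ν) = 0 :=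
  Submodule.Quotient.eq nullSpace

theorem degSup_eq_of_mk_eq (μ ν : Bel) (h : AZ.mk μ = AZ.mk ν) : degSup μ = degSup ν := by
  have h1 : degSup (μ - ν) = 0 := (AZ.mk_eq_mk_iff μ ν).1 h
  have h2 : degSup (ν - μ) = 0 := (AZ.mk_eq_mk_iff ν μ).1 h.symm
  have h3 := degSup_add_le (μ - ν) ν
  have h4 := degSup_add_le (ν - μ) μ
  rw [sub_add_cancel] at h3 h4
  linarith

/-- The infinitesimal asymptotic norm on `AZ(𝔻)`, induced by the degenerating seminorm. -/
def AZ.normFun (x : AZ) : ℝ :=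
  Quotient.liftOn' x degSup fun μ ν h =>
    degSup_eq_of_mk_eq μ ν (Quotient.sound' h : (Quotient.mk'' μ : Bel ⧸ nullSpace) = _)

theorem AZ.normFun_mk (μ : Bel) : AZ.normFun (AZ.mk μ) = degSup μ := rfl

/-- The infinitesimal asymptotic norm as a norm on the additive group `AZ(𝔻)`. -/
def AZ.groupNorm : AddGroupNorm AZ where
  toFun := AZ.normFun
  map_zero' := by
    rw [← map_zero AZ.mk, AZ.normFun_mk, degSup_zero]
  add_le' x y := by
    obtain ⟨μ, rfl⟩ := AZ.mk_surjective x
    obtain ⟨ν, rfl⟩ := AZ.mk_surjective y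
    rw [← map_add]
    exact degSup_add_le μ ν
  neg' x := by
    obtain ⟨μ, rfl⟩ := AZ.mk_surjective x
    rw [← map_neg]
    exact map_neg_eq_map degSeminorm μ
  eq_zero_of_map_eq_zero' x hx := by
    obtain ⟨μ, rfl⟩ := AZ.mk_surjective x
    rw [← map_zero AZ.mk, AZ.mk_eq_mk_iff, sub_zero]
    exact hx

/-- `AZ(𝔻)` with the infinitesimal asymptotic norm and the metric `‖x - y‖`. -/
instance : NormedAddCommGroup AZ := AZ.groupNorm.toNormedAddCommGroup

theorem AZ.norm_mk (μ : Bel) : ‖AZ.mk μ‖ = degSup μ := rfl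

theorem AZ.dist_mk (μ ν : Bel) : dist (AZ.mk μ) (AZ.mk ν) = degSup (μ - ν) := by
  rw [dist_eq_norm, ← map_sub, AZ.norm_mk]

instance : NormedSpace ℂ AZ where
  norm_smul_le c x := by
    obtain ⟨μ, rfl⟩ := AZ.mk_surjective x
    rw [← map_smul]
    exact degSup_smul_le c μ

/-- `b*(ν)`: the infimum over compact `E ⊆ 𝔻` of the essential supremum of `|ν|` on `𝔻 \ E`. -/
def bStar (ν : Bel) : ℝ≥0∞ :=
  ⨅ (E : Set ℂ) (_ : IsCompact E) (_ : E ⊆ disc),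
    essSup (fun z => ‖ν z‖ₑ) ((volume : Measure ℂ).restrict (disc \ E))

/-- The boundary dilatation of `ν` at `p`: the infimum over open `U` containing `p` of the
essential supremum of `|ν|` on `U ∩ 𝔻`. -/
def bStarAt (p : ℂ) (ν : Bel) : ℝ≥0∞ :=
  ⨅ (U : Set ℂ) (_ : IsOpen U) (_ : p ∈ U),
    essSup (fun z => ‖ν z‖ₑ) ((volume : Measure ℂ).restrict (U ∩ disc))

/-- The boundary dilatation `b` of a point of `AZ(𝔻)`: the infimum of `b*(ν)` over all its
representatives `ν`. -/
def bDil (x : AZ) : ℝ≥0∞ := ⨅ (ν : Bel) (_ : AZ.mk ν = x), bStar ν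

/-- The boundary dilatation `b_p` at `p` of a point of `AZ(𝔻)`. -/
def bDilAt (p : ℂ) (x : AZ) : ℝ≥0∞ := ⨅ (ν : Bel) (_ : AZ.mk ν = x), bStarAt p ν

/-- The boundary point `p` is a substantial boundary point for `x`. -/
def IsSubstantialBoundaryPoint (x : AZ) (p : ℂ) : Prop := bDil x = bDilAt p x

/-- `x` is a substantial point of `AZ(𝔻)`: every point of `∂𝔻` is a substantial boundary point
for `x`. -/
def IsSubstantialPoint (x : AZ) : Prop :=
  ∀ p ∈ frontier disc, IsSubstantialBoundaryPoint x p

/-- `G` is a geodesic joining `x` and `y`: the isometric image of a compact interval `[a, b]`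
with `a < b`, the endpoints of the interval being mapped to `x` and `y`. -/
def IsGeodesicJoining {X : Type*} [MetricSpace X] (G : Set X) (x y : X) : Prop :=
  ∃ (a b : ℝ) (γ : ℝ → X), a < b ∧
    (∀ s ∈ Set.Icc a b, ∀ t ∈ Set.Icc a b, dist (γ s) (γ t) = |s - t|) ∧
    γ a = x ∧ γ b = y ∧ G = γ '' Set.Icc a b

end AsymptoticTangent

end

/-! In a normed space, suppose `x` is not an extreme point of the ball of radius `‖x‖`: some `h ≠ 0`
has `‖x ± h‖ ≤ ‖x‖`. Then for `t ∈ [0, 1]` the point `(x + t h) / 2` lies at distance exactly `‖x‖ /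
2` from both `x` and `0`, and the broken lines through these points are pairwise distinct geodesics
(`infinite_isGeodesicJoining`). It remains to find `h` for a non-substantial class.

A Hahn–Banach argument with a weighted `L¹` norm gives `b(x) ≤ ‖x‖` (`bDil_mk_le`), so some
representative `ν` satisfies `|ν| ≤ c < ‖x‖` near a boundary point `p`. Perturb it by `h` with `|h|
≤ (‖x‖ - c) f`, where `f` is a cutoff at `p`. To bound the pairing of `ν + h` with a degenerating
`φ_n`, split `φ_n = (1 - f) φ_n + f φ_n`. On the second piece the pointwise bound gives `‖x‖ ∫ f
|φ_n|`. The first piece is not holomorphic, but multiplication by a function continuous on the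
closed disc keeps degenerating sequences holomorphic up to a small `L¹` error
(`isApproxMultiplier_of_continuousOn`), so it contributes at most `‖x‖ ∫ (1 - f) |φ_n|` up to a
small error. The two masses add up to `1`, whence `‖x + h‖ ≤ ‖x‖`
(`degSup_add_le_of_small_support`); the same bound applies to `-h`.

The class of `h` is made nonzero by matching its phase to the functions `(1 - p̄ z + e)⁻²`, whose
mass concentrates at `p` as `e → 0` (`degSup_pos_of_peakPhase`). -/

noncomputable section

namespace AsymptoticTangent

/-! ### Geodesics in a normed space through a varying midpoint. -/

section Geodesics

variable {E : Type*} [NormedAddCommGroup E] [NormedSpace ℝ E]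

/-- The broken line from `x` to `0` through `m`, parametrised on `[0, ‖x‖]`. -/
def brokenLine (x m : E) (s : ℝ) : E :=
  if s ≤ ‖x‖ / 2 then x + (2 * s / ‖x‖) • (m - x) else (2 * (‖x‖ - s) / ‖x‖) • m

theorem dist_brokenLine_le {x m : E} (hx : x ≠ 0) (hm : ‖m‖ = ‖x‖ / 2) (hxm : ‖x - m‖ = ‖x‖ / 2)
    {s t : ℝ} (hst : s ≤ t) : dist (brokenLine x m s) (brokenLine x m t) ≤ t - s := by
  have hr : 0 < ‖x‖ := norm_pos_iff.2 hx
  have hr' : ‖x‖ ≠ 0 := hr.ne'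
  have hn : ∀ (c : ℝ) (v : E), 0 ≤ c → ‖v‖ = ‖x‖ / 2 → ‖(2 * c / ‖x‖) • v‖ = c := by
    intro c v hc hv
    rw [norm_smul, hv, Real.norm_of_nonneg (by positivity)]
    field_simp
  rw [dist_eq_norm]
  unfold brokenLine
  split_ifs with h1 h2 h2
  · have : x + (2 * s / ‖x‖) • (m - x) - (x + (2 * t / ‖x‖) • (m - x))
        = (2 * (t - s) / ‖x‖) • (x - m) := by module
    rw [this, hn _ _ (by linarith) hxm]
  · have : x + (2 * s / ‖x‖) • (m - x) - (2 * (‖x‖ - t) / ‖x‖) • m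
        = (2 * (‖x‖ / 2 - s) / ‖x‖) • (x - m) + (2 * (t - ‖x‖ / 2) / ‖x‖) • m := by
      match_scalars <;> field_simp <;> ring
    rw [this]
    refine (norm_add_le _ _).trans ?_
    rw [hn _ _ (by linarith) hxm, hn _ _ (by linarith) hm]
    linarith
  · linarith
  · have : (2 * (‖x‖ - s) / ‖x‖) • m - (2 * (‖x‖ - t) / ‖x‖) • m
        = (2 * (t - s) / ‖x‖) • m := by module
    rw [this, hn _ _ (by linarith) hm]

theorem brokenLine_zero (x m : E) : brokenLine x m 0 = x := by
  have : (0 : ℝ) ≤ ‖x‖ / 2 := by positivity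
  simp [brokenLine, this]

theorem brokenLine_norm {x : E} (hx : x ≠ 0) (m : E) : brokenLine x m ‖x‖ = 0 := by
  have hr : 0 < ‖x‖ := norm_pos_iff.2 hx
  simp [brokenLine, hr]

theorem brokenLine_half {x : E} (hx : x ≠ 0) (m : E) : brokenLine x m (‖x‖ / 2) = m := by
  have hr : ‖x‖ ≠ 0 := norm_ne_zero_iff.2 hx
  rw [brokenLine, if_pos le_rfl]
  match_scalars <;> field_simp
  ring

/-- The upper bounds on `[0, s]`, `[s, t]` and `[t, ‖x‖]` add up to the distance `‖x‖` between the
endpoints, so by the triangle inequality none of them can be strict. -/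
theorem dist_brokenLine {x m : E} (hx : x ≠ 0) (hm : ‖m‖ = ‖x‖ / 2) (hxm : ‖x - m‖ = ‖x‖ / 2)
    {s t : ℝ} (hs : s ∈ Set.Icc 0 ‖x‖) (ht : t ∈ Set.Icc 0 ‖x‖) :
    dist (brokenLine x m s) (brokenLine x m t) = |s - t| := by
  wlog hst : s ≤ t generalizing s t with H
  · rw [dist_comm, abs_sub_comm]
    exact H ht hs (le_of_not_ge hst)
  rw [abs_sub_comm, abs_of_nonneg (by linarith)]
  refine le_antisymm (dist_brokenLine_le hx hm hxm hst) ?_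
  have h1 := dist_brokenLine_le hx hm hxm hs.1
  have h2 := dist_brokenLine_le hx hm hxm ht.2
  have h3 := dist_triangle4 (brokenLine x m 0) (brokenLine x m s) (brokenLine x m t)
    (brokenLine x m ‖x‖)
  have h4 : dist (brokenLine x m 0) (brokenLine x m ‖x‖) = ‖x‖ := by
    rw [brokenLine_zero, brokenLine_norm hx, dist_zero_right]
  linarith

/-- If `x` is not an extreme point of the ball of radius `‖x‖`, then infinitely many geodesics
join `x` with `0`. -/
theorem infinite_isGeodesicJoining {x h : E} (hx : x ≠ 0) (hh : h ≠ 0) (hadd : ‖x + h‖ ≤ ‖x‖)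
    (hsub : ‖x - h‖ ≤ ‖x‖) : {G : Set E | IsGeodesicJoining G x 0}.Infinite := by
  have key : ∀ t ∈ Set.Icc (0 : ℝ) 1, ‖x + t • h‖ ≤ ‖x‖ ∧ ‖x - t • h‖ ≤ ‖x‖ := by
    intro t ht
    have aux : ∀ v : E, ‖x + v‖ ≤ ‖x‖ → ‖x + t • v‖ ≤ ‖x‖ := by
      intro v hv
      have : x + t • v = (1 - t) • x + t • (x + v) := by module
      rw [this]
      refine (norm_add_le _ _).trans ?_
      rw [norm_smul, norm_smul, Real.norm_of_nonneg ht.1, Real.norm_of_nonneg (by linarith [ht.2])]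
      nlinarith [ht.1]
    refine ⟨aux h hadd, ?_⟩
    have := aux (-h) (by rwa [← sub_eq_add_neg])
    rwa [smul_neg, ← sub_eq_add_neg] at this
  have half : ∀ t ∈ Set.Icc (0 : ℝ) 1, ‖(1 / 2 : ℝ) • (x + t • h)‖ = ‖x‖ / 2 ∧
      ‖x - (1 / 2 : ℝ) • (x + t • h)‖ = ‖x‖ / 2 := by
    intro t ht
    have e : x - (1 / 2 : ℝ) • (x + t • h) = (1 / 2 : ℝ) • (x - t • h) := by module
    -- `x` is a sum of two vectors of norm at most `‖x‖ / 2`, so both norms equal `‖x‖ / 2`.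
    have e2 : x = (1 / 2 : ℝ) • (x + t • h) + (1 / 2 : ℝ) • (x - t • h) := by module
    have h3 := norm_add_le ((1 / 2 : ℝ) • (x + t • h)) ((1 / 2 : ℝ) • (x - t • h))
    rw [← e2] at h3
    rw [e]
    have hk := key t ht
    rw [norm_smul, norm_smul] at h3 ⊢
    norm_num at h3 ⊢
    constructor <;> linarith [hk.1, hk.2]
  set G : ℝ → Set E := fun t =>
    brokenLine x ((1 / 2 : ℝ) • (x + t • h)) '' Set.Icc 0 ‖x‖ with hG
  have hr : 0 < ‖x‖ := norm_pos_iff.2 hx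
  -- Each geodesic has a single point at distance `‖x‖ / 2` from `0`, its break point, so the set
  -- alone determines `t`.
  have hinj : Set.InjOn G (Set.Icc 0 1) := by
    intro s hs t ht hst
    have hmem : (1 / 2 : ℝ) • (x + s • h) ∈ G t := by
      rw [← hst]
      exact ⟨‖x‖ / 2, ⟨by linarith, by linarith⟩, brokenLine_half hx _⟩
    obtain ⟨u, hu, hu'⟩ := hmem
    have hd := dist_brokenLine hx (half t ht).1 (half t ht).2 hu (Set.right_mem_Icc.2 hr.le)
    rw [hu', brokenLine_norm hx, dist_zero_right, (half s hs).1, abs_sub_comm,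
      abs_of_nonneg (by linarith [hu.2])] at hd
    have hu2 : u = ‖x‖ / 2 := by linarith
    rw [hu2, brokenLine_half hx] at hu'
    have h5 : (t - s) • h = 0 := by
      have h6 := sub_eq_zero.2 hu'
      have h7 : (1 / 2 : ℝ) • (x + t • h) - (1 / 2 : ℝ) • (x + s • h)
          = (1 / 2 : ℝ) • ((t - s) • h) := by module
      rw [h7] at h6
      exact (smul_eq_zero.1 h6).resolve_left (by norm_num)
    have := (smul_eq_zero.1 h5).resolve_right hh
    linarith
  refine Set.Infinite.mono ?_ ((Set.Icc_infinite (zero_lt_one' ℝ)).image hinj)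
  rintro _ ⟨t, ht, rfl⟩
  exact ⟨0, ‖x‖, _, hr, fun a ha b hb => dist_brokenLine hx (half t ht).1 (half t ht).2 ha hb,
    brokenLine_zero _ _, brokenLine_norm hx _, rfl⟩

end Geodesics

/-! ### Duality of `L¹` and `L^∞` for a finite measure, through the Riesz theorem in `L²`. -/

section Duality

variable {α : Type*} [MeasurableSpace α] {m : Measure α}

theorem integrable_mul_Lp_one {κ : α → ℂ} {C : ℝ} (hκ : AEStronglyMeasurable κ m)
    (hC : ∀ᵐ z ∂m, ‖κ z‖ ≤ C) (g : Lp ℂ 1 m) : Integrable (fun z => κ z * g z) m :=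
  (L1.integrable_coeFn g).bdd_mul hκ hC

/-- Integration against an essentially bounded function, as a continuous functional on `L¹`. -/
def integralMulCLM {κ : α → ℂ} {C : ℝ} (hκ : AEStronglyMeasurable κ m)
    (hC : ∀ᵐ z ∂m, ‖κ z‖ ≤ C) : Lp ℂ 1 m →L[ℂ] ℂ :=
  LinearMap.mkContinuous
    { toFun := fun g => ∫ z, κ z * g z ∂m
      map_add' := fun f g => by
        rw [← integral_add (integrable_mul_Lp_one hκ hC f) (integrable_mul_Lp_one hκ hC g)]
        refine integral_congr_ae ?_
        filter_upwards [Lp.coeFn_add f g] with z hz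
        rw [hz, Pi.add_apply, mul_add]
      map_smul' := fun c g => by
        rw [RingHom.id_apply, smul_eq_mul, ← integral_const_mul]
        refine integral_congr_ae ?_
        filter_upwards [Lp.coeFn_smul c g] with z hz
        rw [hz, Pi.smul_apply, smul_eq_mul]
        ring } C fun g => by
    rw [L1.norm_eq_integral_norm, ← integral_const_mul]
    refine norm_integral_le_of_norm_le ((L1.integrable_coeFn g).norm.const_mul _) ?_
    filter_upwards [hC] with z hz
    rw [norm_mul]
    gcongr

theorem integralMulCLM_apply {κ : α → ℂ} {C : ℝ} (hκ : AEStronglyMeasurable κ m)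
    (hC : ∀ᵐ z ∂m, ‖κ z‖ ≤ C) (g : Lp ℂ 1 m) :
    integralMulCLM hκ hC g = ∫ z, κ z * g z ∂m := rfl

/-- The inclusion of `L²` into `L¹` for a finite measure. -/
def L2ToL1 [IsFiniteMeasure m] : Lp ℂ 2 m →L[ℂ] Lp ℂ 1 m :=
  LinearMap.mkContinuous
    { toFun := fun f => MemLp.toLp (f : α → ℂ) ((Lp.memLp f).mono_exponent one_le_two)
      map_add' := fun f g => by
        rw [← MemLp.toLp_add]
        exact MemLp.toLp_congr _ _ (Lp.coeFn_add f g)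
      map_smul' := fun c g => by
        rw [RingHom.id_apply, ← MemLp.toLp_const_smul]
        exact MemLp.toLp_congr _ _ (Lp.coeFn_smul c g) } (m.real Set.univ ^ (1 / 2 : ℝ)) fun f => by
    change ‖MemLp.toLp (f : α → ℂ) ((Lp.memLp f).mono_exponent one_le_two)‖ ≤ _
    rw [Lp.norm_toLp]
    have h := eLpNorm_le_eLpNorm_mul_rpow_measure_univ (p := 1) (q := 2) (μ := m) one_le_two
      (Lp.aestronglyMeasurable f)
    have h2 := ENNReal.toReal_mono (ENNReal.mul_ne_top (Lp.eLpNorm_ne_top f)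
      (ENNReal.rpow_ne_top_of_nonneg (by norm_num) (measure_ne_top _ _))) h
    rw [ENNReal.toReal_mul, ← ENNReal.toReal_rpow, mul_comm] at h2
    rw [Lp.norm_def]
    refine h2.trans_eq ?_
    norm_num [Measure.real]

theorem coeFn_L2ToL1 [IsFiniteMeasure m] (f : Lp ℂ 2 m) : L2ToL1 f =ᵐ[m] f :=
  MemLp.coeFn_toLp ((Lp.memLp f).mono_exponent one_le_two)

theorem exists_L2_representative [IsFiniteMeasure m] (L : Lp ℂ 1 m →L[ℂ] ℂ) :
    ∃ ν : α → ℂ, MemLp ν 2 m ∧ ∀ f : Lp ℂ 2 m, L (L2ToL1 f) = ∫ z, ν z * f z ∂m := by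
  set v := (InnerProductSpace.toDual ℂ (Lp ℂ 2 m)).symm (L.comp L2ToL1)
  refine ⟨fun z => star (v z), (Lp.memLp v).star, fun f => ?_⟩
  have h : inner ℂ v f = L (L2ToL1 f) := InnerProductSpace.toDual_symm_apply
  rw [← h, L2.inner_def]
  refine integral_congr_ae (Eventually.of_forall fun z => ?_)
  simp [mul_comm]

theorem norm_sign_le_one (z : ℂ) : ‖star z / (‖z‖ : ℂ)‖ ≤ 1 := by
  rw [norm_div, norm_star, Complex.norm_real, norm_norm]
  exact div_self_le_one _

theorem mul_sign (z : ℂ) : z * (star z / (‖z‖ : ℂ)) = ‖z‖ := by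
  rcases eq_or_ne z 0 with rfl | hz
  · simp
  · have : (‖z‖ : ℂ) ≠ 0 := by simpa using hz
    rw [← mul_div_assoc, div_eq_iff this, ← sq]
    exact Complex.mul_conj' z

/-- Every continuous functional on `L¹` of a finite measure is the integral against a function
that is essentially bounded by the norm of the functional. -/
theorem exists_bounded_representative [IsFiniteMeasure m] (L : Lp ℂ 1 m →L[ℂ] ℂ) :
    ∃ ν : α → ℂ, AEStronglyMeasurable ν m ∧ (∀ᵐ z ∂m, ‖ν z‖ ≤ ‖L‖) ∧
      ∀ g : Lp ℂ 1 m, L g = ∫ z, ν z * g z ∂m := by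
  obtain ⟨ν, hν, hL⟩ := exists_L2_representative L
  have hνi : Integrable ν m := hν.integrable one_le_two
  -- Testing `L` on the conjugate phase of `ν` restricted to `s` gives `∫_s |ν| ≤ ‖L‖ m(s)` for
  -- every measurable `s`.
  have hb : ∀ᵐ z ∂m, ‖ν z‖ ≤ ‖L‖ := by
    refine ae_le_of_forall_setIntegral_le hνi.norm (integrable_const _) fun s hs hsm => ?_
    have hmeas : AEStronglyMeasurable (fun z => star (ν z) / (‖ν z‖ : ℂ)) m := by
      have h1 := hνi.aestronglyMeasurable.aemeasurable
      refine AEMeasurable.aestronglyMeasurable ?_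
      exact (continuous_star.measurable.comp_aemeasurable h1).div
        (Complex.measurable_ofReal.comp_aemeasurable h1.norm)
    have hmem : MemLp (s.indicator fun z => star (ν z) / (‖ν z‖ : ℂ)) 2 m :=
      (MemLp.of_bound hmeas 1 (Eventually.of_forall fun z => norm_sign_le_one _)).indicator hs
    have e1 := hL (hmem.toLp _)
    have e2 : ∫ z, ν z * (hmem.toLp _ : Lp ℂ 2 m) z ∂m = ((∫ z in s, ‖ν z‖ ∂m : ℝ) : ℂ) := by
      rw [← integral_complex_ofReal, ← integral_indicator hs]
      refine integral_congr_ae ?_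
      filter_upwards [hmem.coeFn_toLp] with z hz
      rw [hz]
      by_cases hzs : z ∈ s
      · simp only [Set.indicator_of_mem hzs]
        exact mul_sign _
      · simp [hzs]
    have e3 : ‖L2ToL1 (hmem.toLp _)‖ ≤ m.real s := by
      rw [L1.norm_eq_integral_norm]
      have : ∫ z, s.indicator (fun _ => (1 : ℝ)) z ∂m = m.real s := by
        rw [integral_indicator hs]; simp
      rw [← this]
      refine integral_mono_ae (L1.integrable_coeFn _).norm
        ((integrable_const _).indicator hs) ?_
      filter_upwards [hmem.coeFn_toLp, coeFn_L2ToL1 (hmem.toLp _)] with z hz hz2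
      rw [hz2, hz]
      by_cases hzs : z ∈ s
      · simp only [Set.indicator_of_mem hzs]
        exact norm_sign_le_one _
      · simp [hzs]
    have e4 := L.le_opNorm (L2ToL1 (hmem.toLp _))
    rw [e1, e2, Complex.norm_real] at e4
    calc ∫ z in s, ‖ν z‖ ∂m ≤ ‖L‖ * ‖L2ToL1 (hmem.toLp _)‖ := (le_abs_self _).trans e4
      _ ≤ ‖L‖ * m.real s := by gcongr
      _ = ∫ z in s, ‖L‖ ∂m := by simp [mul_comm]
  refine ⟨ν, hνi.aestronglyMeasurable, hb, fun g => ?_⟩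
  -- Indicators lie in `L²`, where the formula is known; additivity and `L¹`-continuity of both
  -- sides carry it to all of `L¹`.
  refine Lp.induction (p := 1) ENNReal.one_ne_top
    (fun g : Lp ℂ 1 m => L g = ∫ z, ν z * g z ∂m) ?_ ?_ ?_ g
  · intro c s hs hms
    have h1 : (Lp.simpleFunc.indicatorConst 1 hs hms.ne c : Lp ℂ 1 m)
        = L2ToL1 (indicatorConstLp 2 hs hms.ne c) := by
      rw [Lp.simpleFunc.coe_indicatorConst]
      refine Lp.ext ?_
      exact indicatorConstLp_coeFn.trans (indicatorConstLp_coeFn.symm.trans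
        (coeFn_L2ToL1 _).symm)
    rw [h1, hL]
    refine integral_congr_ae ?_
    filter_upwards [coeFn_L2ToL1 (indicatorConstLp 2 hs hms.ne c)] with z hz
    rw [hz]
  · intro f g hf hg _ hf' hg'
    have e := (integralMulCLM hνi.aestronglyMeasurable hb).map_add (hf.toLp f) (hg.toLp g)
    simp only [integralMulCLM_apply] at e
    rw [map_add, hf', hg', e]
  · exact isClosed_eq L.continuous (integralMulCLM hνi.aestronglyMeasurable hb).continuous

/-- A function whose integrals against a subspace of `L¹` are bounded by the norm can be replaced
by a function in the unit ball of `L^∞`. -/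
theorem exists_unit_of_norm_integral_le [IsFiniteMeasure m] (S : Submodule ℂ (Lp ℂ 1 m))
    {κ : α → ℂ} {C : ℝ} (hκ : AEStronglyMeasurable κ m) (hC : ∀ᵐ z ∂m, ‖κ z‖ ≤ C)
    (h : ∀ g ∈ S, ‖∫ z, κ z * g z ∂m‖ ≤ ‖g‖) :
    ∃ ν : α → ℂ, AEStronglyMeasurable ν m ∧ (∀ᵐ z ∂m, ‖ν z‖ ≤ 1) ∧
      ∀ g ∈ S, ∫ z, ν z * g z ∂m = ∫ z, κ z * g z ∂m := by
  set ℓ : S →L[ℂ] ℂ := (integralMulCLM hκ hC).comp S.subtypeL with hℓ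
  -- Hahn–Banach, preserving the norm.
  obtain ⟨L, hL1, hL2⟩ := exists_extension_norm_eq S ℓ
  have hn : ‖ℓ‖ ≤ 1 := ℓ.opNorm_le_bound zero_le_one fun g => by
    rw [one_mul]
    exact h g g.2
  obtain ⟨ν, hν, hb, hν2⟩ := exists_bounded_representative L
  refine ⟨ν, hν, hb.mono fun z hz => hz.trans (hL2.trans_le hn), fun g hg => ?_⟩
  rw [← hν2 g, hL1 ⟨g, hg⟩]
  rfl

end Duality

/-! ### The area mean value inequality for holomorphic functions. -/

section MeanValue

open scoped Real

theorem enorm_le_lintegral_circle {φ : ℂ → ℂ} {z : ℂ} {R r : ℝ} (hr : 0 < r) (hrR : r < R)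
    (hφ : DifferentiableOn ℂ φ (Metric.ball z R)) :
    ENNReal.ofReal (2 * π) * ‖φ z‖ₑ ≤ ∫⁻ θ in Set.Ioo (-π) π, ‖φ (circleMap z r θ)‖ₑ := by
  have hd : DiffContOnCl ℂ φ (Metric.ball z |r|) := by
    rw [abs_of_pos hr]
    refine DifferentiableOn.diffContOnCl (hφ.mono ?_)
    rw [closure_ball z hr.ne']
    exact Metric.closedBall_subset_ball hrR
  have h := hd.circleAverage
  rw [Real.circleAverage_eq_integral_add (-π),
    intervalIntegral.integral_comp_add_right (fun θ => φ (circleMap z r θ)),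
    show (0 : ℝ) + -π = -π by ring, show 2 * π + -π = π by ring,
    intervalIntegral.integral_of_le (by linarith [Real.pi_pos]), integral_Ioc_eq_integral_Ioo] at h
  rw [← h, enorm_smul, Real.enorm_of_nonneg (by positivity), ← mul_assoc,
    ← ENNReal.ofReal_mul (by positivity), mul_inv_cancel₀ (by positivity), ENNReal.ofReal_one,
    one_mul]
  exact enorm_integral_le_lintegral_enorm _

/-- The sub-mean value property of `|φ|` over discs, for holomorphic `φ`. -/
theorem volume_ball_mul_enorm_le {φ : ℂ → ℂ} {z : ℂ} {R : ℝ}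
    (hφ : DifferentiableOn ℂ φ (Metric.ball z R)) :
    volume (Metric.ball z R) * ‖φ z‖ₑ ≤ ∫⁻ w in Metric.ball z R, ‖φ w‖ₑ := by
  -- Polar coordinates centred at `z`. The formula serves both for `‖φ‖ₑ` and for the constant `‖φ
  -- z‖ₑ`; lower integrals require no integrability of `φ` up to the edge of the ball.
  have key : ∀ G : ℂ → ℝ≥0∞, Measurable ((Metric.ball z R).indicator G) →
      ∫⁻ w in Metric.ball z R, G w = ∫⁻ r in Set.Ioi (0 : ℝ), ∫⁻ θ in Set.Ioo (-π) π,
        ENNReal.ofReal r * (Metric.ball z R).indicator G (circleMap z r θ) := by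
    intro G hG
    rw [← lintegral_indicator Metric.isOpen_ball.measurableSet,
      ← lintegral_add_left_eq_self _ z, ← Complex.lintegral_comp_polarCoord_symm,
      polarCoord_target, Measure.volume_eq_prod, ← Measure.prod_restrict, lintegral_prod]
    · refine lintegral_congr fun r => lintegral_congr fun θ => ?_
      simp only [Complex.polarCoord_symm_apply, smul_eq_mul, circleMap, Complex.exp_mul_I,
        Complex.ofReal_cos, Complex.ofReal_sin]
    · refine Measurable.aemeasurable ?_
      simp only [Complex.polarCoord_symm_apply, smul_eq_mul]
      refine (by fun_prop : Measurable fun p : ℝ × ℝ => ENNReal.ofReal p.1).mul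
        (hG.comp ?_)
      fun_prop
  have hm : Measurable ((Metric.ball z R).indicator fun w => ‖φ w‖ₑ) := by
    have h1 := hφ.continuousOn.enorm
    classical
    have := h1.measurable_piecewise (g := 0) continuousOn_const
      Metric.isOpen_ball.measurableSet
    rwa [Set.piecewise_eq_indicator] at this
  rw [key _ hm, mul_comm, ← setLIntegral_const,
    key _ (measurable_const.indicator Metric.isOpen_ball.measurableSet)]
  refine setLIntegral_mono' measurableSet_Ioi fun r hr => ?_
  have hr0 : (0 : ℝ) < r := hr
  have hdist : ∀ θ, circleMap z r θ ∈ Metric.ball z R ↔ r < R := fun θ => by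
    simp [Metric.mem_ball, dist_eq_norm, circleMap, abs_of_pos hr0]
  by_cases hrR : r < R
  · simp only [Set.indicator, hdist, hrR, if_true]
    rw [lintegral_const_mul' _ _ ENNReal.ofReal_ne_top,
      lintegral_const_mul' _ _ ENNReal.ofReal_ne_top]
    refine mul_le_mul' le_rfl ?_
    rw [setLIntegral_const, Real.volume_Ioo, mul_comm, show π - -π = 2 * π by ring]
    exact enorm_le_lintegral_circle hr0 hrR hφ
  · simp [Set.indicator, hdist, hrR]

end MeanValue

/-! ### Degenerating sequences without the normalisation. -/

section LocallyNull

theorem measurableSet_disc : MeasurableSet disc := Metric.isOpen_ball.measurableSet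

theorem volume_disc_ne_top : volume disc ≠ ∞ := measure_ball_lt_top.ne

instance isFiniteMeasure_disc : IsFiniteMeasure ((volume : Measure ℂ).restrict disc) :=
  ⟨by rw [Measure.restrict_apply_univ]; exact volume_disc_ne_top.lt_top⟩

theorem mem_disc {z : ℂ} : z ∈ disc ↔ ‖z‖ < 1 := mem_ball_zero_iff

/-- An `L¹`-bounded sequence of integrable holomorphic functions on the disc that converges to `0`
locally uniformly. -/
structure IsLocallyNull (φ : ℕ → ℂ → ℂ) : Prop where
  holo : ∀ n, DifferentiableOn ℂ (φ n) disc
  integrable : ∀ n, IntegrableOn (φ n) disc volume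
  bounded : ∃ C, ∀ n, ∫ z in disc, ‖φ n z‖ ≤ C
  small : ∀ ρ < 1, ∀ ε > 0, ∀ᶠ n in atTop, ∀ z, ‖z‖ ≤ ρ → ‖φ n z‖ ≤ ε

theorem exists_radius {K : Set ℂ} (hK : IsCompact K) (hKD : K ⊆ disc) :
    ∃ ρ < 1, ∀ z ∈ K, ‖z‖ ≤ ρ := by
  rcases K.eq_empty_or_nonempty with rfl | hne
  · exact ⟨0, zero_lt_one, by simp⟩
  · obtain ⟨z, hz, hmax⟩ := hK.exists_isMaxOn hne continuous_norm.continuousOn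
    exact ⟨‖z‖, mem_disc.1 (hKD hz), fun w hw => hmax hw⟩

theorem IsDegenerating.isLocallyNull {φ : ℕ → ℂ → ℂ} (h : IsDegenerating φ) :
    IsLocallyNull φ where
  holo n := (h.unit n).holo
  integrable n := (h.unit n).integrable
  bounded := ⟨1, fun n => (h.unit n).norm_eq_one.le⟩
  small ρ hρ ε hε := by
    have h1 := h.tendsto (Metric.closedBall 0 ρ) (isCompact_closedBall _ _)
      (Metric.closedBall_subset_ball hρ)
    filter_upwards [Metric.tendstoUniformlyOn_iff.1 h1 ε hε] with n hn z hz
    have := hn z (mem_closedBall_zero_iff.2 hz)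
    rw [dist_zero_left] at this
    exact this.le

theorem IsLocallyNull.isDegenerating {φ : ℕ → ℂ → ℂ} (h : IsLocallyNull φ)
    (h1 : ∀ n, ∫ z in disc, ‖φ n z‖ = 1) : IsDegenerating φ where
  unit n := ⟨h.holo n, h.integrable n, h1 n⟩
  tendsto K hK hKD := by
    obtain ⟨ρ, hρ, hKρ⟩ := exists_radius hK hKD
    refine Metric.tendstoUniformlyOn_iff.2 fun ε hε => ?_
    filter_upwards [h.small ρ hρ (ε / 2) (half_pos hε)] with n hn z hz
    rw [dist_zero_left]
    exact (hn z (hKρ z hz)).trans_lt (half_lt_self hε)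

theorem integrable_bel_mul (μ : Bel) {φ : ℂ → ℂ} (hφ : IntegrableOn φ disc volume) :
    Integrable (fun z => μ z * φ z) ((volume : Measure ℂ).restrict disc) :=
  Integrable.bdd_mul hφ (Lp.aestronglyMeasurable μ) (ae_norm_le μ)

theorem norm_pairing_le_mul (μ : Bel) {φ : ℂ → ℂ} (hφ : IntegrableOn φ disc volume) :
    ‖pairing μ φ‖ ≤ ‖μ‖ * ∫ z in disc, ‖φ z‖ := by
  rw [← integral_const_mul]
  refine norm_integral_le_of_norm_le (hφ.norm.const_mul _) ?_
  filter_upwards [ae_norm_le μ] with z hz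
  rw [norm_mul]
  gcongr

theorem pairing_const_smul (μ : Bel) (c : ℂ) (φ : ℂ → ℂ) :
    pairing μ (fun z => c * φ z) = c * pairing μ φ := by
  unfold pairing
  rw [← integral_const_mul]
  congr 1
  ext z
  ring

/-- Mean value inequality on the ball of radius `(1 - ρ) / 2` about `z`, which stays inside the disc
of radius `(1 + ρ) / 2`. -/
theorem norm_le_setIntegral_ball {φ : ℂ → ℂ} (hφ : DifferentiableOn ℂ φ disc)
    (hi : IntegrableOn φ disc volume) {ρ : ℝ} (hρ : ρ < 1) {z : ℂ} (hz : ‖z‖ ≤ ρ) :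
    ‖φ z‖ ≤ (Real.pi * ((1 - ρ) / 2) ^ 2)⁻¹ *
      ∫ w in Metric.ball (0 : ℂ) ((1 + ρ) / 2), ‖φ w‖ := by
  have hR : 0 < (1 - ρ) / 2 := by linarith
  have hsub : Metric.ball z ((1 - ρ) / 2) ⊆ Metric.ball 0 ((1 + ρ) / 2) := by
    refine Metric.ball_subset_ball' ?_
    rw [dist_zero_right]
    linarith
  have hsub2 : Metric.ball (0 : ℂ) ((1 + ρ) / 2) ⊆ disc :=
    Metric.ball_subset_ball (by linarith)
  have hi2 := hi.mono_set hsub2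
  have h := (volume_ball_mul_enorm_le (hφ.mono (hsub.trans hsub2))).trans
    (lintegral_mono_set hsub)
  rw [← ofReal_integral_norm_eq_lintegral_enorm hi2, Complex.volume_ball, ← ofReal_norm,
    ← ENNReal.ofReal_coe_nnreal, ← ENNReal.ofReal_pow hR.le,
    ← ENNReal.ofReal_mul (by positivity), ← ENNReal.ofReal_mul (by positivity),
    ENNReal.ofReal_le_ofReal_iff (by positivity)] at h
  rw [← div_eq_inv_mul, le_div_iff₀ (by positivity)]
  refine le_trans (le_of_eq ?_) h
  simp
  ring

theorem small_of_setIntegral_small {φ : ℕ → ℂ → ℂ} (hφ : ∀ n, DifferentiableOn ℂ (φ n) disc)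
    (hi : ∀ n, IntegrableOn (φ n) disc volume)
    (h : ∀ ρ < 1, ∀ ε > 0, ∀ᶠ n in atTop, ∫ z in Metric.ball (0 : ℂ) ρ, ‖φ n z‖ ≤ ε) :
    ∀ ρ < 1, ∀ ε > 0, ∀ᶠ n in atTop, ∀ z, ‖z‖ ≤ ρ → ‖φ n z‖ ≤ ε := by
  intro ρ hρ ε hε
  have hR : 0 < (1 - ρ) / 2 := by linarith
  have hc : 0 < Real.pi * ((1 - ρ) / 2) ^ 2 := by positivity
  filter_upwards [h ((1 + ρ) / 2) (by linarith) _ (mul_pos hc hε)] with n hn z hz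
  refine (norm_le_setIntegral_ball (hφ n) (hi n) hρ hz).trans ?_
  rw [← div_eq_inv_mul, div_le_iff₀ hc, mul_comm]
  linarith

theorem IsLocallyNull.comp {φ : ℕ → ℂ → ℂ} (h : IsLocallyNull φ) {s : ℕ → ℕ}
    (hs : StrictMono s) : IsLocallyNull fun k => φ (s k) where
  holo _ := h.holo _
  integrable _ := h.integrable _
  bounded := h.bounded.imp fun _ hC _ => hC _
  small ρ hρ ε hε := hs.tendsto_atTop.eventually (h.small ρ hρ ε hε)

/-- Normalising a locally null sequence whose norms are bounded below gives a degenerating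
sequence. -/
theorem IsLocallyNull.normalize {φ : ℕ → ℂ → ℂ} (h : IsLocallyNull φ) {c : ℝ} (hc : 0 < c)
    (hb : ∀ n, c ≤ ∫ z in disc, ‖φ n z‖) :
    IsDegenerating fun n z => (((∫ z in disc, ‖φ n z‖)⁻¹ : ℝ) : ℂ) * φ n z := by
  have hpos : ∀ n, 0 < ∫ z in disc, ‖φ n z‖ := fun n => hc.trans_le (hb n)
  have hnorm : ∀ n, ∫ z in disc, ‖(((∫ z in disc, ‖φ n z‖)⁻¹ : ℝ) : ℂ) * φ n z‖ = 1 := by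
    intro n
    simp_rw [norm_mul, Complex.norm_real, Real.norm_of_nonneg (inv_nonneg.2 (hpos n).le)]
    rw [integral_const_mul, inv_mul_cancel₀ (hpos n).ne']
  refine IsLocallyNull.isDegenerating ⟨fun n => (h.holo n).const_mul _,
    fun n => (h.integrable n).const_mul _, ⟨1, fun n => (hnorm n).le⟩, ?_⟩ hnorm
  intro ρ hρ ε hε
  filter_upwards [h.small ρ hρ (c * ε) (by positivity)] with n hn z hz
  rw [norm_mul, Complex.norm_real, Real.norm_of_nonneg (inv_nonneg.2 (hpos n).le),
    ← div_eq_inv_mul, div_le_iff₀ (hpos n), mul_comm]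
  exact (hn z hz).trans (mul_le_mul_of_nonneg_right (hb n) hε.le)

theorem limsup_le_degSup (μ : Bel) {φ : ℕ → ℂ → ℂ} (hφ : IsDegenerating φ) :
    limsup (fun n => ‖pairing μ (φ n)‖) atTop ≤ degSup μ :=
  le_ciSup (bddAbove_limsup μ) (⟨φ, hφ⟩ : {φ : ℕ → ℂ → ℂ // IsDegenerating φ})

/-- The homogeneous form of the definition of `degSup`, usable when the masses vary or tend to `0`.
A subsequence violating it could be normalised to a degenerating sequence whose limsup exceeds
`degSup μ`. -/
theorem IsLocallyNull.eventually_norm_pairing_le {φ : ℕ → ℂ → ℂ} (h : IsLocallyNull φ) (μ : Bel)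
    {ε : ℝ} (hε : 0 < ε) :
    ∀ᶠ n in atTop, ‖pairing μ (φ n)‖ ≤ degSup μ * (∫ z in disc, ‖φ n z‖) + ε := by
  by_contra hcon
  rw [not_eventually] at hcon
  simp only [not_le] at hcon
  obtain ⟨s, hs, hlt⟩ := extraction_of_frequently_atTop hcon
  obtain ⟨C, hC⟩ := h.bounded
  have hC' : ∀ n, ∫ z in disc, ‖φ n z‖ ≤ max C 1 := fun n => (hC n).trans (le_max_left _ _)
  have hC1 : 0 < max C 1 := lt_max_of_lt_right one_pos
  have hN : ∀ n, 0 ≤ ∫ z in disc, ‖φ n z‖ := fun n => integral_nonneg fun _ => norm_nonneg _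
  -- A pairing larger than `ε` forces a definite mass, which makes normalisation legitimate.
  have hlow : ∀ k, ε / (‖μ‖ + 1) ≤ ∫ z in disc, ‖φ (s k) z‖ := by
    intro k
    rw [div_le_iff₀ (by positivity)]
    have h1 := norm_pairing_le_mul μ (h.integrable (s k))
    have h2 := mul_nonneg (degSup_nonneg μ) (hN (s k))
    nlinarith [hlt k, hN (s k)]
  have hc : 0 < ε / (‖μ‖ + 1) := by positivity
  have hdeg := (h.comp hs).normalize hc hlow
  have h1 := limsup_le_degSup μ hdeg
  have h2 : degSup μ + ε / max C 1 ≤ limsup (fun k => ‖pairing μ fun z =>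
      (((∫ z in disc, ‖φ (s k) z‖)⁻¹ : ℝ) : ℂ) * φ (s k) z‖) atTop := by
    refine le_limsup_of_frequently_le (Frequently.of_forall fun k => ?_)
      (isBoundedUnder_le μ hdeg)
    have hp : 0 < ∫ z in disc, ‖φ (s k) z‖ := hc.trans_le (hlow k)
    rw [pairing_const_smul, norm_mul, Complex.norm_real,
      Real.norm_of_nonneg (inv_nonneg.2 hp.le), ← div_eq_inv_mul, le_div_iff₀ hp, add_mul]
    refine le_trans ?_ (hlt k).le
    gcongr
    rw [div_mul_eq_mul_div, div_le_iff₀ hC1]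
    gcongr
    exact hC' _
  have h3 : 0 < ε / max C 1 := by positivity
  linarith

end LocallyNull

/-! ### The inequality `b ≤ ‖·‖` and representatives that are small near a boundary point. -/

section BoundaryDilatation

/-- The radial weight that equals `a` on the disc of radius `ρ` and `b` outside of it. -/
def radialWeight (ρ a b : ℝ) (z : ℂ) : ℝ := if ‖z‖ < ρ then a else b

theorem measurable_radialWeight (ρ a b : ℝ) : Measurable (radialWeight ρ a b) :=
  Measurable.ite (measurableSet_lt measurable_norm measurable_const) measurable_const
    measurable_const

theorem integral_radialWeight {φ : ℂ → ℂ} (hφ : IntegrableOn φ disc volume) {ρ : ℝ} (hρ : ρ ≤ 1)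
    (a b : ℝ) : ∫ z in disc, radialWeight ρ a b z * ‖φ z‖
      = b * (∫ z in disc, ‖φ z‖) + (a - b) * ∫ z in Metric.ball (0 : ℂ) ρ, ‖φ z‖ := by
  have hs : Metric.ball (0 : ℂ) ρ ⊆ disc := Metric.ball_subset_ball hρ
  have hm : MeasurableSet (Metric.ball (0 : ℂ) ρ) := Metric.isOpen_ball.measurableSet
  have e : ∀ z, radialWeight ρ a b z * ‖φ z‖
      = b * ‖φ z‖ + (Metric.ball (0 : ℂ) ρ).indicator (fun z => (a - b) * ‖φ z‖) z := by
    intro z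
    by_cases hz : ‖z‖ < ρ
    · rw [Set.indicator_of_mem (mem_ball_zero_iff.2 hz), radialWeight, if_pos hz]
      ring
    · rw [Set.indicator_of_notMem (by rwa [mem_ball_zero_iff]), radialWeight, if_neg hz, add_zero]
  simp_rw [e]
  rw [integral_add (hφ.norm.const_mul b) ((hφ.norm.const_mul (a - b)).indicator hm),
    integral_const_mul, integral_indicator hm, Measure.restrict_restrict hm,
    Set.inter_eq_left.2 hs, integral_const_mul]

/-- The functional that `μ` induces on integrable holomorphic functions is bounded by a weighted
norm whose weight near the boundary is as close to the degenerating seminorm as we wish. -/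
theorem exists_norm_pairing_le_weight (μ : Bel) {ε : ℝ} (hε : 0 < ε) :
    ∃ ρ < 1, ∃ a > 0, ∀ φ : ℂ → ℂ, DifferentiableOn ℂ φ disc → IntegrableOn φ disc volume →
      ‖pairing μ φ‖ ≤ ∫ z in disc, radialWeight ρ a (degSup μ + ε) z * ‖φ z‖ := by
  -- Take `ρ = 1 - 1/(n+1)` and `a = n + 1`. The normalised counterexamples have pairings bounded by
  -- `‖μ‖`, so the large inner weight forces their mass on each smaller disc to tend to `0`. They
  -- are thus degenerating, yet their pairings exceed `degSup μ + ε`.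
  by_contra! hcon
  have hρ : ∀ n : ℕ, 1 - 1 / ((n : ℝ) + 1) < 1 := fun n => by
    have : (0 : ℝ) < 1 / ((n : ℝ) + 1) := by positivity
    linarith
  have hunit : ∀ n : ℕ, ∃ φ : ℂ → ℂ, IsUnitQuadDiff φ ∧
      degSup μ + ε + ((n : ℝ) + 1 - (degSup μ + ε)) *
        (∫ z in Metric.ball (0 : ℂ) (1 - 1 / ((n : ℝ) + 1)), ‖φ z‖) < ‖pairing μ φ‖ := by
    intro n
    obtain ⟨φ, hol, hi, hlt⟩ := hcon _ (hρ n) ((n : ℝ) + 1) (by positivity)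
    rw [integral_radialWeight hi (hρ n).le] at hlt
    set N := ∫ z in disc, ‖φ z‖ with hN
    set I := ∫ z in Metric.ball (0 : ℂ) (1 - 1 / ((n : ℝ) + 1)), ‖φ z‖ with hI
    have hI0 : 0 ≤ I := integral_nonneg fun _ => norm_nonneg _
    have hIN : I ≤ N := setIntegral_mono_set hi.norm (Eventually.of_forall fun _ => norm_nonneg _)
      (Metric.ball_subset_ball (hρ n).le).eventuallyLE
    have hN0 : 0 < N := by
      refine (hI0.trans hIN).lt_of_ne fun h0 => ?_
      have h1 := norm_pairing_le_mul μ hi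
      rw [← hN, ← h0, mul_zero] at h1
      rw [← h0] at hlt hIN
      rw [le_antisymm hIN hI0] at hlt
      linarith
    have hnorm : ∀ z, ‖((N⁻¹ : ℝ) : ℂ) * φ z‖ = N⁻¹ * ‖φ z‖ := fun z => by
      rw [norm_mul, Complex.norm_real, Real.norm_of_nonneg (inv_nonneg.2 hN0.le)]
    refine ⟨fun z => ((N⁻¹ : ℝ) : ℂ) * φ z, ⟨hol.const_mul _, hi.const_mul _, ?_⟩, ?_⟩
    · simp_rw [hnorm]
      rw [integral_const_mul, ← hN, inv_mul_cancel₀ hN0.ne']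
    · simp_rw [hnorm]
      rw [integral_const_mul, ← hI, pairing_const_smul, norm_mul, Complex.norm_real,
        Real.norm_of_nonneg (inv_nonneg.2 hN0.le), ← div_eq_inv_mul ‖_‖, lt_div_iff₀ hN0]
      refine lt_of_eq_of_lt ?_ hlt
      field_simp
  choose φ hφ hlt using hunit
  have hlarge : ∀ x : ℝ, ∀ᶠ n : ℕ in atTop, x ≤ (n : ℝ) := fun x =>
    tendsto_natCast_atTop_atTop.eventually_ge_atTop x
  have hnull : IsLocallyNull φ := by
    refine ⟨fun n => (hφ n).holo, fun n => (hφ n).integrable,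
      ⟨1, fun n => (hφ n).norm_eq_one.le⟩,
      small_of_setIntegral_small (fun n => (hφ n).holo) (fun n => (hφ n).integrable) ?_⟩
    intro ρ hρ1 η hη
    filter_upwards [hlarge (‖μ‖ / η + (degSup μ + ε)), hlarge (1 / (1 - ρ))] with n hn hn2
    have h1 : ρ ≤ 1 - 1 / ((n : ℝ) + 1) := by
      have h2 : 0 < 1 - ρ := by linarith
      rw [div_le_iff₀ h2] at hn2
      have h3 : 1 / ((n : ℝ) + 1) ≤ 1 - ρ := by
        rw [div_le_iff₀ (by positivity)]
        linarith
      linarith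
    have h4 : ∫ z in Metric.ball (0 : ℂ) ρ, ‖φ n z‖
        ≤ ∫ z in Metric.ball (0 : ℂ) (1 - 1 / ((n : ℝ) + 1)), ‖φ n z‖ :=
      setIntegral_mono_set
        ((hφ n).integrable.norm.mono_measure
          (Measure.restrict_mono (Metric.ball_subset_ball (hρ n).le) le_rfl))
        (Eventually.of_forall fun _ => norm_nonneg _) (Metric.ball_subset_ball h1).eventuallyLE
    refine h4.trans ?_
    have h5 := (hlt n).trans_le (norm_pairing_le μ (hφ n))
    have h6 : ‖μ‖ ≤ ((n : ℝ) - (degSup μ + ε)) * η := by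
      rw [← div_le_iff₀ hη]
      linarith
    have h7 : 0 ≤ ‖μ‖ / η := by positivity
    have h8 := degSup_nonneg μ
    by_contra! h9
    have h10 : ((n : ℝ) + 1 - (degSup μ + ε)) * η ≤ ((n : ℝ) + 1 - (degSup μ + ε)) *
        ∫ z in Metric.ball (0 : ℂ) (1 - 1 / ((n : ℝ) + 1)), ‖φ n z‖ :=
      mul_le_mul_of_nonneg_left h9.le (by linarith)
    linarith
  obtain ⟨n, h1, h2⟩ := ((hnull.eventually_norm_pairing_le μ (half_pos hε)).and
    (hlarge (degSup μ + ε))).exists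
  rw [(hφ n).norm_eq_one] at h1
  have h3 := hlt n
  have h4 : 0 ≤ ((n : ℝ) + 1 - (degSup μ + ε)) *
      (∫ z in Metric.ball (0 : ℂ) (1 - 1 / ((n : ℝ) + 1)), ‖φ n z‖) :=
    mul_nonneg (by linarith) (integral_nonneg fun _ => norm_nonneg _)
  linarith

theorem degSup_eq_zero_of_pairing {μ : Bel} (h : ∀ φ, IsUnitQuadDiff φ → pairing μ φ = 0) :
    degSup μ = 0 := by
  refine le_antisymm (Real.iSup_le (fun φ => ?_) le_rfl) (degSup_nonneg μ)
  simp [h _ (φ.2.unit _)]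

theorem exists_bel {ν : ℂ → ℂ} (hν : AEStronglyMeasurable ν ((volume : Measure ℂ).restrict disc))
    {C : ℝ} (hC : ∀ᵐ z ∂((volume : Measure ℂ).restrict disc), ‖ν z‖ ≤ C) :
    ∃ ν' : Bel, ν' =ᵐ[(volume : Measure ℂ).restrict disc] ν :=
  ⟨(memLp_top_of_bound hν C hC).toLp ν, MemLp.coeFn_toLp _⟩

/-- Writing `g = w φ`, the hypothesis says that integration against `μ / w` has norm at most `1` on
a subspace of `L¹`. Duality replaces `μ / w` by a function of modulus at most `1` with the same
integrals there; multiplied by `w`, it pairs with every integrable holomorphic function as `μ` does,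
hence lies in the same class. -/
theorem exists_mk_eq_of_norm_pairing_le (μ : Bel) {ρ a b : ℝ} (ha : 0 < a) (hb : 0 < b)
    (h : ∀ φ : ℂ → ℂ, DifferentiableOn ℂ φ disc → IntegrableOn φ disc volume →
      ‖pairing μ φ‖ ≤ ∫ z in disc, radialWeight ρ a b z * ‖φ z‖) :
    ∃ ν : Bel, AZ.mk ν = AZ.mk μ ∧
      ∀ᵐ z ∂((volume : Measure ℂ).restrict disc), ‖ν z‖ ≤ radialWeight ρ a b z := by
  set w : ℂ → ℝ := radialWeight ρ a b with hw
  have hwm : Measurable w := measurable_radialWeight ρ a b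
  have hwpos : ∀ z, 0 < w z := fun z => by
    rw [hw, radialWeight]
    split_ifs <;> assumption
  have hwle : ∀ z, w z ≤ max a b := fun z => by
    rw [hw, radialWeight]
    split_ifs
    exacts [le_max_left _ _, le_max_right _ _]
  have hwge : ∀ z, min a b ≤ w z := fun z => by
    rw [hw, radialWeight]
    split_ifs
    exacts [min_le_left _ _, min_le_right _ _]
  have hmin : 0 < min a b := lt_min ha hb
  have hwc : Measurable fun z => (w z : ℂ) := Complex.measurable_ofReal.comp hwm
  have hwi : ∀ φ : ℂ → ℂ, IntegrableOn φ disc volume →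
      IntegrableOn (fun z => (w z : ℂ) * φ z) disc volume := fun φ hφ =>
    Integrable.bdd_mul (c := max a b) hφ hwc.aestronglyMeasurable (Eventually.of_forall fun z => by
      rw [Complex.norm_real, Real.norm_of_nonneg (hwpos z).le]
      exact hwle z)
  let S : Submodule ℂ (Lp ℂ 1 ((volume : Measure ℂ).restrict disc)) :=
    { carrier := {g | ∃ φ : ℂ → ℂ, DifferentiableOn ℂ φ disc ∧ IntegrableOn φ disc volume ∧
        g =ᵐ[(volume : Measure ℂ).restrict disc] fun z => (w z : ℂ) * φ z}
      add_mem' := by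
        rintro f g ⟨φ, h1, h2, h3⟩ ⟨ψ, h4, h5, h6⟩
        refine ⟨fun z => φ z + ψ z, h1.add h4, h2.add h5, ?_⟩
        filter_upwards [Lp.coeFn_add f g, h3, h6] with z hz hz1 hz2
        rw [hz, Pi.add_apply, hz1, hz2, mul_add]
      zero_mem' := by
        refine ⟨fun _ => 0, differentiableOn_const _, integrable_zero _ _ _, ?_⟩
        filter_upwards [Lp.coeFn_zero ℂ 1 ((volume : Measure ℂ).restrict disc)] with z hz
        rw [mul_zero]
        exact hz
      smul_mem' := by
        rintro c f ⟨φ, h1, h2, h3⟩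
        refine ⟨fun z => c * φ z, h1.const_mul c, h2.const_mul c, ?_⟩
        filter_upwards [Lp.coeFn_smul c f, h3] with z hz hz1
        rw [hz, Pi.smul_apply, hz1, smul_eq_mul]
        ring }
  have hκ : AEStronglyMeasurable (fun z => μ z / (w z : ℂ))
      ((volume : Measure ℂ).restrict disc) :=
    ((Lp.aestronglyMeasurable μ).aemeasurable.div hwc.aemeasurable).aestronglyMeasurable
  have hκC : ∀ᵐ z ∂((volume : Measure ℂ).restrict disc),
      ‖μ z / (w z : ℂ)‖ ≤ ‖μ‖ / min a b := by
    filter_upwards [ae_norm_le μ] with z hz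
    rw [norm_div, Complex.norm_real, Real.norm_of_nonneg (hwpos z).le]
    gcongr
    exact hwge z
  have hκφ : ∀ (g : Lp ℂ 1 ((volume : Measure ℂ).restrict disc)) (φ : ℂ → ℂ),
      g =ᵐ[(volume : Measure ℂ).restrict disc] (fun z => (w z : ℂ) * φ z) →
      ∫ z in disc, μ z / (w z : ℂ) * g z = pairing μ φ := by
    intro g φ hg
    refine integral_congr_ae ?_
    filter_upwards [hg] with z hz
    have : (w z : ℂ) ≠ 0 := by exact_mod_cast (hwpos z).ne'
    rw [hz]
    field_simp
  obtain ⟨ν, hν, hν1, hν2⟩ := exists_unit_of_norm_integral_le S hκ hκC (by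
    rintro g ⟨φ, h1, h2, h3⟩
    rw [hκφ g φ h3, L1.norm_eq_integral_norm]
    refine (h φ h1 h2).trans_eq (integral_congr_ae ?_)
    filter_upwards [h3] with z hz
    rw [hz, norm_mul, Complex.norm_real, Real.norm_of_nonneg (hwpos z).le])
  have hνw : ∀ᵐ z ∂((volume : Measure ℂ).restrict disc), ‖(w z : ℂ) * ν z‖ ≤ w z := by
    filter_upwards [hν1] with z hz
    rw [norm_mul, Complex.norm_real, Real.norm_of_nonneg (hwpos z).le]
    exact mul_le_of_le_one_right (hwpos z).le hz
  obtain ⟨ν', hν'⟩ := exists_bel (ν := fun z => (w z : ℂ) * ν z)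
    (hwc.aestronglyMeasurable.mul hν) (C := max a b) (hνw.mono fun z hz => hz.trans (hwle z))
  refine ⟨ν', ?_, ?_⟩
  · rw [AZ.mk_eq_mk_iff]
    refine degSup_eq_zero_of_pairing fun φ hφ => ?_
    have e1 : pairing ν' φ = pairing μ φ := by
      have hg := (hwi φ hφ.integrable).coeFn_toL1
      rw [← hκφ _ φ hg, ← hν2 _ ⟨φ, hφ.holo, hφ.integrable, hg⟩]
      refine integral_congr_ae ?_
      filter_upwards [hg, hν'] with z hz hz2
      rw [hz, hz2]
      ring
    have e2 := pairing_add (ν' - μ) μ hφ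
    rw [sub_add_cancel, e1] at e2
    simpa using e2
  · filter_upwards [hν', hνw] with z hz hz2
    rwa [hz]

/-- The boundary dilatation of a class is at most its norm. -/
theorem bDil_mk_le (μ : Bel) : bDil (AZ.mk μ) ≤ ENNReal.ofReal (degSup μ) := by
  refine ENNReal.le_of_forall_pos_le_add fun ε hε _ => ?_
  have hε' : (0 : ℝ) < ε := hε
  obtain ⟨ρ, hρ, a, ha, h⟩ := exists_norm_pairing_le_weight μ hε'
  have hb : 0 < degSup μ + ε := by linarith [degSup_nonneg μ]
  obtain ⟨ν, hν, hle⟩ := exists_mk_eq_of_norm_pairing_le μ ha hb h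
  -- Off the closed disc of radius `ρ` the weight is `degSup μ + ε`.
  refine (iInf₂_le ν hν).trans ((iInf_le _ (Metric.closedBall 0 ρ)).trans
    ((iInf₂_le (isCompact_closedBall _ _) (Metric.closedBall_subset_ball hρ)).trans ?_))
  rw [← ENNReal.ofReal_coe_nnreal, ← ENNReal.ofReal_add (degSup_nonneg μ) hε'.le]
  refine essSup_le_of_ae_le _ ?_
  have hm : MeasurableSet (disc \ Metric.closedBall (0 : ℂ) ρ) :=
    measurableSet_disc.diff Metric.isClosed_closedBall.measurableSet
  filter_upwards [ae_restrict_of_ae_restrict_of_subset Set.sdiff_subset hle, ae_restrict_mem hm]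
    with z hz hz2
  have h3 : ¬ ‖z‖ < ρ := fun h4 => hz2.2 (mem_closedBall_zero_iff.2 h4.le)
  rw [radialWeight, if_neg h3] at hz
  rw [← ofReal_norm]
  exact ENNReal.ofReal_le_ofReal hz

theorem norm_eq_one_of_mem_frontier {p : ℂ} (hp : p ∈ frontier disc) : ‖p‖ = 1 := by
  rw [disc, frontier_ball _ one_ne_zero, mem_sphere_zero_iff_norm] at hp
  exact hp

/-- The complement of a compact subset of the disc is an open neighbourhood of `p`. -/
theorem bStarAt_le_bStar {p : ℂ} (hp : p ∈ frontier disc) (ν : Bel) : bStarAt p ν ≤ bStar ν := by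
  refine le_iInf fun E => le_iInf₂ fun hE hED => ?_
  have hpd : p ∉ disc := by
    rw [mem_disc, norm_eq_one_of_mem_frontier hp]
    exact lt_irrefl 1
  refine (iInf_le _ Eᶜ).trans
    ((iInf₂_le hE.isClosed.isOpen_compl fun h => hpd (hED h)).trans_eq ?_)
  rw [Set.inter_comm, Set.sdiff_eq]

theorem bDilAt_le_bDil {p : ℂ} (hp : p ∈ frontier disc) (x : AZ) : bDilAt p x ≤ bDil x :=
  iInf₂_mono fun ν _ => bStarAt_le_bStar hp ν

/-- A non-substantial class has a representative that is smaller than the norm near some boundary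
point. -/
theorem exists_small_representative {x : AZ} (hx : ¬ IsSubstantialPoint x) :
    ∃ p : ℂ, ‖p‖ = 1 ∧ ∃ ν : Bel, AZ.mk ν = x ∧ ∃ c, 0 ≤ c ∧ c < ‖x‖ ∧ ∃ η > 0,
      ∀ᵐ z ∂((volume : Measure ℂ).restrict disc), z ∈ Metric.ball p η → ‖ν z‖ ≤ c := by
  simp only [IsSubstantialPoint, IsSubstantialBoundaryPoint, not_forall] at hx
  obtain ⟨p, hp, hne⟩ := hx
  have hp1 := norm_eq_one_of_mem_frontier hp
  have hb : bDil x ≤ ENNReal.ofReal ‖x‖ := by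
    obtain ⟨μ, rfl⟩ := AZ.mk_surjective x
    exact bDil_mk_le μ
  -- Since `b_p ≤ b` always holds, failure of equality is strict inequality.
  have hlt := ((bDilAt_le_bDil hp x).lt_of_ne (Ne.symm hne)).trans_le hb
  simp only [bDilAt, bStarAt, iInf_lt_iff] at hlt
  obtain ⟨ν, hν, U, hU, hpU, hess⟩ := hlt
  obtain ⟨η, hη, hball⟩ := Metric.isOpen_iff.1 hU p hpU
  set c := essSup (fun z => ‖ν z‖ₑ) ((volume : Measure ℂ).restrict (U ∩ disc)) with hc
  have hct : c ≠ ∞ := (hess.trans ENNReal.ofReal_lt_top).ne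
  refine ⟨p, hp1, ν, hν, c.toReal, ENNReal.toReal_nonneg,
    (ENNReal.lt_ofReal_iff_toReal_lt hct).1 hess, η, hη, ?_⟩
  have h1 : ∀ᵐ z ∂((volume : Measure ℂ).restrict (U ∩ disc)), ‖ν z‖ₑ ≤ c := ae_le_essSup
  rw [← Measure.restrict_restrict hU.measurableSet, ae_restrict_iff' hU.measurableSet] at h1
  filter_upwards [h1] with z hz hzb
  have := ENNReal.toReal_mono hct (hz (hball hzb))
  rwa [toReal_enorm] at this

end BoundaryDilatation

/-! ### Continuous functions as approximate multipliers, by Stone–Weierstrass. -/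

section Multipliers

theorem volume_real_disc : ((volume : Measure ℂ).restrict disc).real Set.univ = Real.pi := by
  simp [Measure.real, disc, Complex.volume_ball]

theorem ae_mem_disc : ∀ᵐ z ∂((volume : Measure ℂ).restrict disc), z ∈ disc :=
  ae_restrict_mem measurableSet_disc

theorem exists_bound_of_continuousOn {g : ℂ → ℂ} (hg : ContinuousOn g (Metric.closedBall 0 1)) :
    ∃ C > 0, ∀ z ∈ disc, ‖g z‖ ≤ C := by
  obtain ⟨C, hC⟩ := (isCompact_closedBall (0 : ℂ) 1).exists_bound_of_continuousOn hg
  exact ⟨max C 1, lt_max_of_lt_right one_pos, fun z hz =>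
    (hC z (Metric.ball_subset_closedBall hz)).trans (le_max_left _ _)⟩

theorem integrableOn_continuousOn_mul {g φ : ℂ → ℂ}
    (hg : ContinuousOn g (Metric.closedBall 0 1)) (hφ : IntegrableOn φ disc volume) :
    IntegrableOn (fun z => g z * φ z) disc volume := by
  obtain ⟨C, -, hC⟩ := exists_bound_of_continuousOn hg
  exact Integrable.bdd_mul hφ
    ((hg.mono Metric.ball_subset_closedBall).aestronglyMeasurable measurableSet_disc)
    (ae_mem_disc.mono hC)

theorem IsLocallyNull.add {φ ψ : ℕ → ℂ → ℂ} (hφ : IsLocallyNull φ) (hψ : IsLocallyNull ψ) :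
    IsLocallyNull fun n z => φ n z + ψ n z where
  holo n := (hφ.holo n).add (hψ.holo n)
  integrable n := (hφ.integrable n).add (hψ.integrable n)
  bounded := by
    obtain ⟨C, hC⟩ := hφ.bounded
    obtain ⟨D, hD⟩ := hψ.bounded
    refine ⟨C + D, fun n => le_trans ?_ (add_le_add (hC n) (hD n))⟩
    rw [← integral_add (hφ.integrable n).norm (hψ.integrable n).norm]
    exact integral_mono ((hφ.integrable n).add (hψ.integrable n)).norm
      ((hφ.integrable n).norm.add (hψ.integrable n).norm) fun z => norm_add_le _ _
  small ρ hρ ε hε := by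
    filter_upwards [hφ.small ρ hρ _ (half_pos hε), hψ.small ρ hρ _ (half_pos hε)] with n h1 h2 z hz
    linarith [norm_add_le (φ n z) (ψ n z), h1 z hz, h2 z hz]

theorem IsLocallyNull.mul_holo {φ : ℕ → ℂ → ℂ} (hφ : IsLocallyNull φ) {g : ℂ → ℂ}
    (hg : Differentiable ℂ g) : IsLocallyNull fun n z => g z * φ n z := by
  obtain ⟨C, hC0, hC⟩ := exists_bound_of_continuousOn hg.continuous.continuousOn
  refine ⟨fun n => hg.differentiableOn.mul (hφ.holo n),
    fun n => integrableOn_continuousOn_mul hg.continuous.continuousOn (hφ.integrable n), ?_, ?_⟩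
  · obtain ⟨D, hD⟩ := hφ.bounded
    refine ⟨C * D, fun n => le_trans ?_ (mul_le_mul_of_nonneg_left (hD n) hC0.le)⟩
    rw [← integral_const_mul]
    refine integral_mono_ae
      (integrableOn_continuousOn_mul hg.continuous.continuousOn (hφ.integrable n)).norm
      ((hφ.integrable n).norm.const_mul C) ?_
    filter_upwards [ae_mem_disc] with z hz
    rw [norm_mul]
    gcongr
    exact hC z hz
  · intro ρ hρ ε hε
    filter_upwards [hφ.small ρ hρ (ε / C) (by positivity)] with n hn z hz
    rw [norm_mul]
    have h1 := hn z hz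
    rw [le_div_iff₀ hC0] at h1
    have h2 := hC z (mem_disc.2 (hz.trans_lt hρ))
    nlinarith [norm_nonneg (φ n z)]

/-- Multiplication by `g` maps locally null sequences to sequences that are approximated in `L¹`
by locally null sequences. -/
def IsApproxMultiplier (g : ℂ → ℂ) : Prop :=
  ∀ φ : ℕ → ℂ → ℂ, IsLocallyNull φ → ∀ ε > 0, ∃ ψ : ℕ → ℂ → ℂ, IsLocallyNull ψ ∧
    ∀ᶠ n in atTop, ∫ z in disc, ‖g z * φ n z - ψ n z‖ ≤ ε

theorem IsApproxMultiplier.of_differentiable {g : ℂ → ℂ} (hg : Differentiable ℂ g) :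
    IsApproxMultiplier g := fun φ hφ ε hε =>
  ⟨_, hφ.mul_holo hg, Eventually.of_forall fun n => by simpa using hε.le⟩

theorem IsApproxMultiplier.congr {f g : ℂ → ℂ} (hf : IsApproxMultiplier f)
    (h : ∀ z ∈ disc, f z = g z) : IsApproxMultiplier g := by
  intro φ hφ ε hε
  obtain ⟨ψ, hψ, h1⟩ := hf φ hφ ε hε
  refine ⟨ψ, hψ, h1.mono fun n hn => le_of_eq_of_le ?_ hn⟩
  exact setIntegral_congr_fun measurableSet_disc fun z hz => by simp only [h z hz]

theorem IsApproxMultiplier.add {f g : ℂ → ℂ} (hf : IsApproxMultiplier f)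
    (hg : IsApproxMultiplier g) (hfc : ContinuousOn f (Metric.closedBall 0 1))
    (hgc : ContinuousOn g (Metric.closedBall 0 1)) : IsApproxMultiplier fun z => f z + g z := by
  intro φ hφ ε hε
  obtain ⟨ψ, hψ, h1⟩ := hf φ hφ _ (half_pos hε)
  obtain ⟨χ, hχ, h2⟩ := hg φ hφ _ (half_pos hε)
  refine ⟨_, hψ.add hχ, ?_⟩
  filter_upwards [h1, h2] with n hn1 hn2
  have i1 := (integrableOn_continuousOn_mul hfc (hφ.integrable n)).sub (hψ.integrable n)
  have i2 := (integrableOn_continuousOn_mul hgc (hφ.integrable n)).sub (hχ.integrable n)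
  have e : ∀ z, (f z + g z) * φ n z - (ψ n z + χ n z)
      = (f z * φ n z - ψ n z) + (g z * φ n z - χ n z) := fun z => by ring
  simp_rw [e]
  calc _ ≤ ∫ z in disc, (‖f z * φ n z - ψ n z‖ + ‖g z * φ n z - χ n z‖) :=
        integral_mono (i1.add i2).norm (i1.norm.add i2.norm) fun z => norm_add_le _ _
    _ = _ := integral_add i1.norm i2.norm
    _ ≤ ε := by linarith

/-- The approximant `ψ` of `g φ` is itself locally null, so `f` can be applied to it; this is why
locally null, not normalised, sequences are used. -/
theorem IsApproxMultiplier.mul {f g : ℂ → ℂ} (hf : IsApproxMultiplier f)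
    (hg : IsApproxMultiplier g) (hfc : ContinuousOn f (Metric.closedBall 0 1))
    (hgc : ContinuousOn g (Metric.closedBall 0 1)) : IsApproxMultiplier fun z => f z * g z := by
  intro φ hφ ε hε
  obtain ⟨C, hC0, hC⟩ := exists_bound_of_continuousOn hfc
  obtain ⟨ψ, hψ, h1⟩ := hg φ hφ (ε / 2 / C) (by positivity)
  obtain ⟨χ, hχ, h2⟩ := hf ψ hψ _ (half_pos hε)
  refine ⟨χ, hχ, ?_⟩
  filter_upwards [h1, h2] with n hn1 hn2
  have i0 := (integrableOn_continuousOn_mul hgc (hφ.integrable n)).sub (hψ.integrable n)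
  have i1 := integrableOn_continuousOn_mul hfc i0
  have i2 := (integrableOn_continuousOn_mul hfc (hψ.integrable n)).sub (hχ.integrable n)
  have e : ∀ z, f z * g z * φ n z - χ n z
      = f z * (g z * φ n z - ψ n z) + (f z * ψ n z - χ n z) := fun z => by ring
  simp_rw [e]
  calc _ ≤ ∫ z in disc, (C * ‖g z * φ n z - ψ n z‖ + ‖f z * ψ n z - χ n z‖) := by
        refine integral_mono_ae (i1.add i2).norm ((i0.norm.const_mul C).add i2.norm) ?_
        filter_upwards [ae_mem_disc] with z hz
        refine (norm_add_le _ _).trans ?_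
        rw [norm_mul]
        gcongr
        exact hC z hz
    _ = C * (∫ z in disc, ‖g z * φ n z - ψ n z‖) + ∫ z in disc, ‖f z * ψ n z - χ n z‖ := by
        rw [← integral_const_mul]
        exact integral_add (i0.norm.const_mul C) i2.norm
    _ ≤ ε := by
        rw [le_div_iff₀ hC0] at hn1
        linarith

theorem IsApproxMultiplier.of_approx {f : ℂ → ℂ} (hfc : ContinuousOn f (Metric.closedBall 0 1))
    (h : ∀ δ > 0, ∃ g : ℂ → ℂ, IsApproxMultiplier g ∧ ContinuousOn g (Metric.closedBall 0 1) ∧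
      ∀ z ∈ disc, ‖f z - g z‖ ≤ δ) : IsApproxMultiplier f := by
  intro φ hφ ε hε
  obtain ⟨C, hC⟩ := hφ.bounded
  have hC1 : 0 < max C 1 := lt_max_of_lt_right one_pos
  obtain ⟨g, hg, hgc, hfg⟩ := h (ε / 2 / max C 1) (by positivity)
  obtain ⟨ψ, hψ, h1⟩ := hg φ hφ _ (half_pos hε)
  refine ⟨ψ, hψ, ?_⟩
  filter_upwards [h1] with n hn
  have i0 := integrableOn_continuousOn_mul (hfc.sub hgc) (hφ.integrable n)
  have i1 := (integrableOn_continuousOn_mul hgc (hφ.integrable n)).sub (hψ.integrable n)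
  have e : ∀ z, f z * φ n z - ψ n z
      = (f z - g z) * φ n z + (g z * φ n z - ψ n z) := fun z => by ring
  simp_rw [e]
  calc _ ≤ ∫ z in disc, (ε / 2 / max C 1 * ‖φ n z‖ + ‖g z * φ n z - ψ n z‖) := by
        refine integral_mono_ae (i0.add i1).norm
          (((hφ.integrable n).norm.const_mul _).add i1.norm) ?_
        filter_upwards [ae_mem_disc] with z hz
        refine (norm_add_le _ _).trans ?_
        rw [norm_mul]
        gcongr
        exact hfg z hz
    _ = ε / 2 / max C 1 * (∫ z in disc, ‖φ n z‖) + ∫ z in disc, ‖g z * φ n z - ψ n z‖ := by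
        rw [← integral_const_mul]
        exact integral_add ((hφ.integrable n).norm.const_mul _) i1.norm
    _ ≤ ε / 2 / max C 1 * max C 1 + ε / 2 := by
        gcongr
        exact (hC n).trans (le_max_left _ _)
    _ = ε := by field_simp; norm_num

theorem differentiableOn_dslope_disc {φ : ℂ → ℂ} (hφ : DifferentiableOn ℂ φ disc) :
    DifferentiableOn ℂ (dslope φ 0) disc :=
  (Complex.differentiableOn_dslope
    (Metric.isOpen_ball.mem_nhds (Metric.mem_ball_self one_pos))).2 hφ

theorem dslope_zero_eq {φ : ℂ → ℂ} {z : ℂ} (hz : z ≠ 0) :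
    dslope φ 0 z = (φ z - φ 0) / z := by
  rw [dslope_of_ne _ hz, slope_def_field, sub_zero]

theorem norm_dslope_le_of_half_le {φ : ℂ → ℂ} {z : ℂ} (hz : 1 / 2 ≤ ‖z‖) :
    ‖dslope φ 0 z‖ ≤ 2 * (‖φ z‖ + ‖φ 0‖) := by
  have h0 : 0 < ‖z‖ := by linarith
  rw [dslope_zero_eq (norm_pos_iff.1 h0), norm_div, div_le_iff₀ h0]
  have h1 := norm_sub_le (φ z) (φ 0)
  nlinarith [norm_nonneg (φ z), norm_nonneg (φ 0)]

/-- Maximum principle: on the circle of radius `ρ ≥ 1/2` the quotient `(φ(z) - φ(0)) / z` is at most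
`2 (A + A)`. -/
theorem norm_dslope_le {φ : ℂ → ℂ} (hφ : DifferentiableOn ℂ φ disc) {ρ A : ℝ} (hρ : 1 / 2 ≤ ρ)
    (hρ1 : ρ < 1) (hA : ∀ z, ‖z‖ ≤ ρ → ‖φ z‖ ≤ A) {z : ℂ} (hz : ‖z‖ ≤ ρ) :
    ‖dslope φ 0 z‖ ≤ 4 * A := by
  have h0 : ρ ≠ 0 := by linarith
  refine Complex.norm_le_of_forall_mem_frontier_norm_le (U := Metric.ball 0 ρ)
    Metric.isBounded_ball ?_ ?_ ?_
  · refine DifferentiableOn.diffContOnCl ((differentiableOn_dslope_disc hφ).mono ?_)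
    rw [closure_ball _ h0]
    exact Metric.closedBall_subset_ball hρ1
  · intro w hw
    rw [frontier_ball _ h0, mem_sphere_zero_iff_norm] at hw
    have h1 := norm_dslope_le_of_half_le (φ := φ) (hρ.trans hw.ge)
    have h2 := hA w hw.le
    have h3 := hA 0 (by rw [norm_zero]; linarith)
    linarith
  · rw [closure_ball _ h0]
    exact mem_closedBall_zero_iff.2 hz

theorem IsLocallyNull.dslope {φ : ℕ → ℂ → ℂ} (hφ : IsLocallyNull φ) :
    IsLocallyNull fun n => dslope (φ n) 0 := by
  obtain ⟨c, hc, hbound⟩ : ∃ c > 0, ∀ n, ∀ z, ‖z‖ ≤ 1 / 2 →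
      ‖φ n z‖ ≤ c * ∫ w in disc, ‖φ n w‖ := by
    refine ⟨(Real.pi * ((1 - 1 / 2) / 2) ^ 2)⁻¹, by positivity, fun n z hz => ?_⟩
    refine (norm_le_setIntegral_ball (hφ.holo n) (hφ.integrable n) (by norm_num) hz).trans
      (mul_le_mul_of_nonneg_left ?_ (by positivity))
    exact setIntegral_mono_set (hφ.integrable n).norm
      (Eventually.of_forall fun _ => norm_nonneg _)
      (Metric.ball_subset_ball (by norm_num)).eventuallyLE
  -- The summands `4` (for `|z| ≤ 1/2`) and `2` (from `φ(0)` when `|z| ≥ 1/2`) are added to cover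
  -- both cases at once.
  have hpt : ∀ n, ∀ᵐ z ∂((volume : Measure ℂ).restrict disc), ‖_root_.dslope (φ n) 0 z‖
      ≤ 6 * (c * ∫ w in disc, ‖φ n w‖) + 2 * ‖φ n z‖ := by
    intro n
    have h0 := hbound n 0 (by simp)
    have hp : 0 ≤ c * ∫ w in disc, ‖φ n w‖ := (norm_nonneg _).trans h0
    refine Eventually.of_forall fun z => ?_
    rcases le_total ‖z‖ (1 / 2) with hz | hz
    · have := norm_dslope_le (hφ.holo n) le_rfl (by norm_num) (hbound n) hz
      linarith [norm_nonneg (φ n z)]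
    · have := norm_dslope_le_of_half_le (φ := φ n) hz
      linarith
  have hint : ∀ n, Integrable (fun z => 6 * (c * ∫ w in disc, ‖φ n w‖) + 2 * ‖φ n z‖)
      ((volume : Measure ℂ).restrict disc) := fun n =>
    (integrable_const _).add ((hφ.integrable n).norm.const_mul 2)
  have hmem : ∀ n, IntegrableOn (_root_.dslope (φ n) 0) disc volume := fun n =>
    (hint n).mono' ((differentiableOn_dslope_disc (hφ.holo n)).continuousOn.aestronglyMeasurable
      measurableSet_disc) (hpt n)
  refine ⟨fun n => differentiableOn_dslope_disc (hφ.holo n), hmem, ?_, ?_⟩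
  · obtain ⟨C, hC⟩ := hφ.bounded
    refine ⟨Real.pi * (6 * (c * C)) + 2 * C, fun n => ?_⟩
    refine (integral_mono_ae (hmem n).norm (hint n) (hpt n)).trans ?_
    rw [integral_add (integrable_const _) ((hφ.integrable n).norm.const_mul 2),
      integral_const_mul 2, integral_const, volume_real_disc, smul_eq_mul]
    have := hC n
    gcongr
  · intro ρ hρ ε hε
    filter_upwards [hφ.small (max ρ (1 / 2)) (max_lt hρ (by norm_num)) (ε / 4) (by positivity)]
      with n hn z hz
    have := norm_dslope_le (hφ.holo n) (le_max_right _ _) (max_lt hρ (by norm_num)) hn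
      (hz.trans (le_max_left _ _))
    linarith

/-- For `|z| ≥ ρ` the difference is `((|z|² - 1) φ(z) + φ(0)) / z`, with `1 - |z|² ≤ 2 (1 - ρ)` and
`1 / |z| ≤ 2`. For `|z| ≤ ρ` both terms are small, at most `η` and `4 η`. -/
theorem norm_conj_mul_sub_dslope_le {φ : ℂ → ℂ} (hφ : DifferentiableOn ℂ φ disc) {ρ η : ℝ}
    (hρ : 1 / 2 ≤ ρ) (hρ1 : ρ < 1) (hη : ∀ z, ‖z‖ ≤ ρ → ‖φ z‖ ≤ η) {z : ℂ} (hz : z ∈ disc) :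
    ‖star z * φ z - dslope φ 0 z‖ ≤ 4 * (1 - ρ) * ‖φ z‖ + 5 * η := by
  have hz1 : ‖z‖ < 1 := mem_disc.1 hz
  have hη0 : ‖φ 0‖ ≤ η := hη 0 (by rw [norm_zero]; linarith)
  rcases le_total ‖z‖ ρ with h | h
  · have h1 := norm_dslope_le hφ hρ hρ1 hη h
    have h2 := hη z h
    have h3 : ‖star z * φ z‖ ≤ ‖φ z‖ := by
      rw [norm_mul, norm_star]
      exact mul_le_of_le_one_left (norm_nonneg _) hz1.le
    have h4 := norm_sub_le (star z * φ z) (dslope φ 0 z)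
    have h5 : 0 ≤ 4 * (1 - ρ) * ‖φ z‖ := mul_nonneg (by linarith) (norm_nonneg _)
    linarith
  · have h0 : 0 < ‖z‖ := by linarith
    have hz0 := norm_pos_iff.1 h0
    have e : star z * φ z - dslope φ 0 z = (((‖z‖ ^ 2 - 1 : ℝ) : ℂ) * φ z + φ 0) / z := by
      rw [dslope_zero_eq hz0, eq_div_iff hz0, sub_mul, div_mul_cancel₀ _ hz0]
      push_cast
      rw [← Complex.conj_mul' z]
      simp only [RCLike.star_def]
      ring
    rw [e, norm_div, div_le_iff₀ h0]
    have h1 := norm_add_le (((‖z‖ ^ 2 - 1 : ℝ) : ℂ) * φ z) (φ 0)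
    rw [norm_mul, Complex.norm_real, Real.norm_eq_abs, abs_sub_comm,
      abs_of_nonneg (by nlinarith)] at h1
    have h2 : (1 - ‖z‖ ^ 2) * ‖φ z‖ ≤ 2 * (1 - ρ) * ‖φ z‖ := by
      gcongr
      nlinarith
    have h3 : 0 ≤ (1 - ρ) * ‖φ z‖ := mul_nonneg (by linarith) (norm_nonneg _)
    have h4 : 0 ≤ η := (norm_nonneg _).trans hη0
    nlinarith

/-- On sequences that concentrate near the unit circle, multiplication by `z̄` is asymptotically
division by `z`. -/
theorem isApproxMultiplier_star : IsApproxMultiplier fun z => star z := by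
  intro φ hφ ε hε
  refine ⟨_, hφ.dslope, ?_⟩
  obtain ⟨C, hC⟩ := hφ.bounded
  have hC1 : 0 < max C 1 := lt_max_of_lt_right one_pos
  -- The radius is `1 - t ≥ 1/2`, and `4 t C ≤ ε / 2`. The pointwise bound `ε / (10 π)` contributes
  -- the other half, the disc having area `π`.
  set t := min (1 / 2) (ε / 2 / (4 * max C 1)) with ht
  have ht0 : 0 < t := lt_min (by norm_num) (by positivity)
  have ht1 : t ≤ 1 / 2 := min_le_left _ _
  have ht2 : t * (4 * max C 1) ≤ ε / 2 := by
    rw [← le_div_iff₀ (by positivity)]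
    exact min_le_right _ _
  have hpi := Real.pi_pos
  filter_upwards [hφ.small (1 - t) (by linarith) (ε / (10 * Real.pi)) (by positivity)] with n hn
  have i1 := (integrableOn_continuousOn_mul continuous_star.continuousOn (hφ.integrable n)).sub
    (hφ.dslope.integrable n)
  have i2 := (hφ.integrable n).norm.const_mul (4 * (1 - (1 - t)))
  calc ∫ z in disc, ‖star z * φ n z - dslope (φ n) 0 z‖
      ≤ ∫ z in disc, (4 * (1 - (1 - t)) * ‖φ n z‖ + 5 * (ε / (10 * Real.pi))) := by
        refine integral_mono_ae i1.norm (i2.add (integrable_const _)) ?_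
        filter_upwards [ae_mem_disc] with z hz
        exact norm_conj_mul_sub_dslope_le (hφ.holo n) (by linarith) (by linarith) hn hz
    _ = 4 * t * (∫ z in disc, ‖φ n z‖) + ε / 2 := by
        rw [integral_add i2 (integrable_const _), integral_const_mul, integral_const,
          volume_real_disc, smul_eq_mul, sub_sub_cancel]
        congr 1
        field_simp
        norm_num
    _ ≤ 4 * t * max C 1 + ε / 2 := by
        gcongr
        exact (hC n).trans (le_max_left _ _)
    _ ≤ ε := by linarith

theorem extend_apply_of_mem (f : C(Metric.closedBall (0 : ℂ) 1, ℂ)) {z : ℂ}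
    (hz : z ∈ Metric.closedBall (0 : ℂ) 1) :
    Function.extend Subtype.val f (fun _ => 0) z = f ⟨z, hz⟩ :=
  Subtype.val_injective.extend_apply f _ ⟨z, hz⟩

theorem continuousOn_extend (f : C(Metric.closedBall (0 : ℂ) 1, ℂ)) :
    ContinuousOn (Function.extend Subtype.val f fun _ => 0) (Metric.closedBall (0 : ℂ) 1) := by
  rw [continuousOn_iff_continuous_domRestrict]
  convert f.continuous using 1
  ext z
  exact extend_apply_of_mem f z.2

/-- Multiplication by a function that is continuous on the closed disc preserves locally null
sequences up to a small error in `L¹`. -/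
theorem isApproxMultiplier_of_continuousOn {g : ℂ → ℂ}
    (hg : ContinuousOn g (Metric.closedBall 0 1)) : IsApproxMultiplier g := by
  have hmem : ∀ z ∈ disc, z ∈ Metric.closedBall (0 : ℂ) 1 := fun z hz =>
    Metric.ball_subset_closedBall hz
  have : CompactSpace (Metric.closedBall (0 : ℂ) 1) :=
    isCompact_iff_compactSpace.1 (isCompact_closedBall _ _)
  have key : ∀ f : C(Metric.closedBall (0 : ℂ) 1, ℂ),
      IsApproxMultiplier (Function.extend Subtype.val f fun _ => 0) := by
    intro f
    -- Constants, `z` and `z̄` generate a dense star subalgebra of the continuous functions on the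
    -- closed disc, so closure under sums, products and uniform limits is enough.
    refine ContinuousMap.induction_on
      (p := fun f => IsApproxMultiplier (Function.extend Subtype.val f fun _ => 0))
      ?_ ?_ ?_ ?_ ?_ ?_ f
    · intro r
      refine (IsApproxMultiplier.of_differentiable (differentiable_const r)).congr fun z hz => ?_
      rw [extend_apply_of_mem _ (hmem z hz)]
      rfl
    · refine (IsApproxMultiplier.of_differentiable differentiable_id).congr fun z hz => ?_
      rw [extend_apply_of_mem _ (hmem z hz)]
      rfl
    · refine isApproxMultiplier_star.congr fun z hz => ?_
      rw [extend_apply_of_mem _ (hmem z hz)]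
      rfl
    · intro f g hf hg
      refine (hf.add hg (continuousOn_extend f) (continuousOn_extend g)).congr fun z hz => ?_
      simp only [extend_apply_of_mem _ (hmem z hz)]
      rfl
    · intro f g hf hg
      refine (hf.mul hg (continuousOn_extend f) (continuousOn_extend g)).congr fun z hz => ?_
      simp only [extend_apply_of_mem _ (hmem z hz)]
      rfl
    · intro h f
      refine IsApproxMultiplier.of_approx (continuousOn_extend f) fun δ hδ => ?_
      have hf : f ∈ (polynomialFunctions
          (Metric.closedBall (0 : ℂ) 1)).starClosure.topologicalClosure := by
        rw [polynomialFunctions.starClosure_topologicalClosure]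
        trivial
      obtain ⟨g, hg, hfg⟩ := Metric.mem_closure_iff.1 hf δ hδ
      refine ⟨_, h g hg, continuousOn_extend g, fun z hz => ?_⟩
      rw [extend_apply_of_mem _ (hmem z hz), extend_apply_of_mem _ (hmem z hz), ← dist_eq_norm]
      exact (ContinuousMap.dist_apply_le_dist _).trans hfg.le
  refine (key ⟨_, continuousOn_iff_continuous_domRestrict.1 hg⟩).congr fun z hz => ?_
  rw [extend_apply_of_mem _ (hmem z hz)]
  rfl

/-- `f φ_n` is not holomorphic, so it is replaced by a locally null `ψ_n` within `δ` in `L¹`. This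
costs `‖μ‖ δ` in the pairing and `degSup μ * δ` in the mass, which fixes the choice of `δ`. -/
theorem eventually_norm_pairing_mul_le (μ : Bel) {φ : ℕ → ℂ → ℂ} (hφ : IsLocallyNull φ)
    {f : ℂ → ℝ} (hf : Continuous f) (hf0 : ∀ z, 0 ≤ f z) {ε : ℝ} (hε : 0 < ε) :
    ∀ᶠ n in atTop, ‖pairing μ (fun z => (f z : ℂ) * φ n z)‖
      ≤ degSup μ * (∫ z in disc, f z * ‖φ n z‖) + ε := by
  have hfc : ContinuousOn (fun z => (f z : ℂ)) (Metric.closedBall 0 1) :=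
    (Complex.continuous_ofReal.comp hf).continuousOn
  have hr := degSup_nonneg μ
  set δ := ε / 2 / (‖μ‖ + degSup μ + 1) with hδ
  have hden : 0 < ‖μ‖ + degSup μ + 1 := by positivity
  have hδ0 : 0 < δ := by positivity
  have hδε : δ * (‖μ‖ + degSup μ + 1) = ε / 2 := div_mul_cancel₀ _ hden.ne'
  obtain ⟨ψ, hψ, h1⟩ := isApproxMultiplier_of_continuousOn hfc φ hφ δ hδ0
  filter_upwards [h1, hψ.eventually_norm_pairing_le μ (half_pos hε)] with n hn1 hn2
  have i0 := integrableOn_continuousOn_mul hfc (hφ.integrable n)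
  have i1 : IntegrableOn (fun z => (f z : ℂ) * φ n z - ψ n z) disc volume :=
    i0.sub (hψ.integrable n)
  have e : pairing μ (fun z => (f z : ℂ) * φ n z)
      = pairing μ (ψ n) + pairing μ (fun z => (f z : ℂ) * φ n z - ψ n z) := by
    unfold pairing
    rw [← integral_add (integrable_bel_mul μ (hψ.integrable n)) (integrable_bel_mul μ i1)]
    congr 1
    ext z
    ring
  have h2 := norm_pairing_le_mul μ i1
  have hnf : ∀ z, ‖(f z : ℂ) * φ n z‖ = f z * ‖φ n z‖ := fun z => by
    rw [norm_mul, Complex.norm_real, Real.norm_of_nonneg (hf0 z)]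
  have h3 : ∫ z in disc, ‖ψ n z‖ ≤ (∫ z in disc, f z * ‖φ n z‖)
      + ∫ z in disc, ‖(f z : ℂ) * φ n z - ψ n z‖ := by
    simp_rw [← hnf]
    rw [← integral_add i0.norm i1.norm]
    refine integral_mono (hψ.integrable n).norm (i0.norm.add i1.norm) fun z => ?_
    have := norm_sub_le ((f z : ℂ) * φ n z) ((f z : ℂ) * φ n z - ψ n z)
    rwa [sub_sub_cancel] at this
  rw [e]
  refine (norm_add_le _ _).trans ?_
  have h4 : degSup μ * (∫ z in disc, ‖ψ n z‖) ≤ degSup μ * ((∫ z in disc, f z * ‖φ n z‖) + δ) :=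
    mul_le_mul_of_nonneg_left (by linarith) hr
  have h5 : ‖μ‖ * (∫ z in disc, ‖(f z : ℂ) * φ n z - ψ n z‖) ≤ ‖μ‖ * δ :=
    mul_le_mul_of_nonneg_left hn1 (norm_nonneg _)
  linarith

end Multipliers

/-! ### Perturbations near a boundary point that do not increase the norm. -/

section Perturbation

/-- Split `φ_n` by `f`. The localised norm bound controls `ν (1 - f) φ_n`, while on the rest `|ν| f
+ |h| ≤ c f + (degSup ν - c) f`. The masses `∫ (1 - f) |φ_n|` and `∫ f |φ_n|` sum to `1`. -/
theorem degSup_add_le_of_small_support {ν h : Bel} {f : ℂ → ℝ} {c : ℝ} (hf : Continuous f)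
    (hf0 : ∀ z, 0 ≤ f z) (hf1 : ∀ z, f z ≤ 1)
    (hν : ∀ᵐ z ∂((volume : Measure ℂ).restrict disc), f z ≠ 0 → ‖ν z‖ ≤ c)
    (hh : ∀ᵐ z ∂((volume : Measure ℂ).restrict disc), ‖h z‖ ≤ (degSup ν - c) * f z) :
    degSup (ν + h) ≤ degSup ν := by
  refine Real.iSup_le (fun φ => ?_) (degSup_nonneg ν)
  obtain ⟨φ, hφ⟩ := φ
  refine le_of_forall_pos_le_add fun ε hε => ?_
  refine limsup_le_of_le (isBoundedUnder_ge _ _).isCoboundedUnder_le ?_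
  filter_upwards [eventually_norm_pairing_mul_le ν hφ.isLocallyNull
    (f := fun z => 1 - f z) (continuous_const.sub hf) (fun z => sub_nonneg.2 (hf1 z)) hε] with n hn
  have hi := (hφ.unit n).integrable
  have hfc : ContinuousOn (fun z => (f z : ℂ)) (Metric.closedBall 0 1) :=
    (Complex.continuous_ofReal.comp hf).continuousOn
  have i1 := integrableOn_continuousOn_mul hfc hi
  have i2 : IntegrableOn (fun z => ((1 - f z : ℝ) : ℂ) * φ n z) disc volume := by
    refine (hi.sub i1).congr (Eventually.of_forall fun z => ?_)
    simp only [Pi.sub_apply]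
    push_cast
    ring
  have i1n : IntegrableOn (fun z => f z * ‖φ n z‖) disc volume := by
    refine i1.norm.congr (Eventually.of_forall fun z => ?_)
    simp only [norm_mul, Complex.norm_real, Real.norm_of_nonneg (hf0 z)]
  have j1 : Integrable (fun z => ν z * ((f z : ℂ) * φ n z) + h z * φ n z)
      ((volume : Measure ℂ).restrict disc) :=
    (integrable_bel_mul ν i1).add (integrable_bel_mul h hi)
  have e : pairing (ν + h) (φ n) = pairing ν (fun z => ((1 - f z : ℝ) : ℂ) * φ n z)
      + ∫ z in disc, (ν z * ((f z : ℂ) * φ n z) + h z * φ n z) := by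
    simp only [pairing]
    rw [← integral_add (integrable_bel_mul ν i2) j1]
    refine integral_congr_ae ?_
    filter_upwards [Lp.coeFn_add ν h] with z hz
    rw [hz, Pi.add_apply]
    push_cast
    ring
  have h2 : ‖∫ z in disc, (ν z * ((f z : ℂ) * φ n z) + h z * φ n z)‖
      ≤ degSup ν * ∫ z in disc, f z * ‖φ n z‖ := by
    rw [← integral_const_mul]
    refine norm_integral_le_of_norm_le (i1n.const_mul _) ?_
    filter_upwards [hν, hh] with z hz1 hz2
    refine (norm_add_le _ _).trans ?_
    rw [norm_mul, norm_mul, norm_mul, Complex.norm_real, Real.norm_of_nonneg (hf0 z)]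
    have h3 : ‖ν z‖ * f z ≤ c * f z := by
      by_cases h0 : f z = 0
      · simp [h0]
      · exact mul_le_mul_of_nonneg_right (hz1 h0) (hf0 z)
    nlinarith [norm_nonneg (φ n z)]
  have h4 : (∫ z in disc, (1 - f z) * ‖φ n z‖) + ∫ z in disc, f z * ‖φ n z‖ = 1 := by
    have i3 : IntegrableOn (fun z => (1 - f z) * ‖φ n z‖) disc volume := by
      refine (hi.norm.sub i1n).congr (Eventually.of_forall fun z => ?_)
      simp only [Pi.sub_apply]
      ring
    rw [← integral_add i3 i1n]
    refine Eq.trans ?_ (hφ.unit n).norm_eq_one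
    congr 1
    ext z
    ring
  calc ‖pairing (ν + h) (φ n)‖ ≤ _ := e ▸ norm_add_le _ _
    _ ≤ (degSup ν * (∫ z in disc, (1 - f z) * ‖φ n z‖) + ε)
        + degSup ν * ∫ z in disc, f z * ‖φ n z‖ := add_le_add hn h2
    _ = degSup ν * ((∫ z in disc, (1 - f z) * ‖φ n z‖) + ∫ z in disc, f z * ‖φ n z‖) + ε := by
        ring
    _ = degSup ν + ε := by rw [h4, mul_one]

end Perturbation

/-! ### Holomorphic functions concentrating at a boundary point. -/

section Peak

theorem norm_le_norm_add {w : ℂ} (hw : 0 ≤ w.re) {e : ℝ} (he : 0 ≤ e) : ‖w‖ ≤ ‖w + e‖ := by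
  rw [← sq_le_sq₀ (norm_nonneg _) (norm_nonneg _), ← Complex.normSq_eq_norm_sq,
    ← Complex.normSq_eq_norm_sq, Complex.normSq_apply, Complex.normSq_apply]
  simp only [Complex.add_re, Complex.add_im, Complex.ofReal_re, Complex.ofReal_im, add_zero]
  nlinarith

theorem le_norm_add {w : ℂ} (hw : 0 ≤ w.re) {e : ℝ} : e ≤ ‖w + e‖ := by
  refine le_trans ?_ (Complex.re_le_norm _)
  simp [hw]

/-- When `9 e ≤ |w|`, adding `e` hardly turns `w`: the angle `θ` between `w` and `w + e` has `cos θ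
≥ 9/10`, so `cos 2θ = 2 cos² θ - 1 ≥ 1/2`. Here `q = w v̄` carries the angle `θ` and `q²` the angle
`2θ`. -/
theorem half_le_re_peak {w : ℂ} (hw : 0 < w.re) {e : ℝ} (he : 0 < e) (hwe : 9 * e ≤ ‖w‖) :
    1 / 2 * (‖w + e‖ ^ 2)⁻¹ ≤ (w ^ 2 / (‖w‖ : ℂ) ^ 2 * ((w + e) ^ 2)⁻¹).re := by
  obtain ⟨v, hv⟩ : ∃ v : ℂ, v = w + e := ⟨_, rfl⟩
  rw [← hv]
  have hw0 : 0 < ‖w‖ := by linarith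
  have hv0 : 0 < ‖v‖ := hv ▸ he.trans_le (le_norm_add hw.le)
  have hwc : (‖w‖ : ℂ) ≠ 0 := by exact_mod_cast hw0.ne'
  have hvc : (‖v‖ : ℂ) ≠ 0 := by exact_mod_cast hv0.ne'
  have hvz : v ≠ 0 := norm_pos_iff.1 hv0
  set q : ℂ := w * (starRingEnd ℂ) v with hq
  have e1 : w ^ 2 / (‖w‖ : ℂ) ^ 2 * (v ^ 2)⁻¹ = ((‖w‖ ^ 2 * ‖v‖ ^ 4)⁻¹ : ℝ) * q ^ 2 := by
    have h : (v ^ 2)⁻¹ = (starRingEnd ℂ) v ^ 2 / (‖v‖ : ℂ) ^ 4 := by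
      rw [inv_eq_one_div, div_eq_div_iff (pow_ne_zero 2 hvz) (pow_ne_zero 4 hvc)]
      linear_combination (-(‖v‖ : ℂ) ^ 2 - (starRingEnd ℂ) v * v) * Complex.conj_mul' v
    rw [hq, h]
    push_cast
    field_simp
  have hqn : ‖q‖ = ‖w‖ * ‖v‖ := by rw [hq, norm_mul, Complex.norm_conj]
  have hqre : ‖w‖ ^ 2 ≤ q.re := by
    rw [← Complex.normSq_eq_norm_sq, Complex.normSq_apply, hq, hv]
    simp only [map_add, Complex.conj_ofReal, Complex.mul_re, Complex.add_re, Complex.conj_re,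
      Complex.ofReal_re, Complex.add_im, Complex.conj_im, Complex.ofReal_im]
    nlinarith
  have hvw : ‖v‖ ≤ 10 / 9 * ‖w‖ := by
    have : ‖v‖ ≤ ‖w‖ + e := by
      rw [hv]
      refine (norm_add_le _ _).trans_eq ?_
      rw [Complex.norm_real, Real.norm_of_nonneg he.le]
    linarith
  have hq2 : 1 / 2 * ‖q‖ ^ 2 ≤ (q ^ 2).re := by
    have h1 : (q ^ 2).re = 2 * q.re ^ 2 - ‖q‖ ^ 2 := by
      rw [← Complex.normSq_eq_norm_sq, Complex.normSq_apply, sq, Complex.mul_re]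
      ring
    have h2 : 9 / 10 * ‖q‖ ≤ q.re := by
      rw [hqn]
      nlinarith
    rw [h1]
    nlinarith [norm_nonneg q]
  rw [e1, Complex.re_ofReal_mul]
  calc 1 / 2 * (‖v‖ ^ 2)⁻¹ = (‖w‖ ^ 2 * ‖v‖ ^ 4)⁻¹ * (1 / 2 * ‖q‖ ^ 2) := by
        rw [hqn]
        field_simp
    _ ≤ _ := by gcongr

/-- The holomorphic function with positive real part on the disc that vanishes at `p`. -/
def toHalfPlane (p z : ℂ) : ℂ := 1 - star p * z

theorem norm_toHalfPlane {p : ℂ} (hp : ‖p‖ = 1) (z : ℂ) : ‖toHalfPlane p z‖ = ‖z - p‖ := by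
  have h : toHalfPlane p z = -(star p * (z - p)) := by
    have := Complex.conj_mul' p
    rw [hp] at this
    rw [toHalfPlane, RCLike.star_def]
    push_cast at this
    linear_combination -this
  rw [h, norm_neg, norm_mul, norm_star, hp, one_mul]

theorem one_sub_norm_le_re_toHalfPlane {p : ℂ} (hp : ‖p‖ = 1) (z : ℂ) :
    1 - ‖z‖ ≤ (toHalfPlane p z).re := by
  have h := Complex.re_le_norm (star p * z)
  rw [norm_mul, norm_star, hp, one_mul] at h
  rw [toHalfPlane, Complex.sub_re, Complex.one_re]
  linarith

theorem re_toHalfPlane_pos {p : ℂ} (hp : ‖p‖ = 1) {z : ℂ} (hz : z ∈ disc) :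
    0 < (toHalfPlane p z).re := by
  have := one_sub_norm_le_re_toHalfPlane hp z
  have := mem_disc.1 hz
  linarith

theorem differentiable_toHalfPlane (p : ℂ) : Differentiable ℂ (toHalfPlane p) := by
  unfold toHalfPlane
  fun_prop

/-- A holomorphic function whose mass concentrates at `p` as `e` tends to `0`. -/
def peak (p : ℂ) (e : ℝ) (z : ℂ) : ℂ := ((toHalfPlane p z + e) ^ 2)⁻¹

theorem norm_peak (p : ℂ) (e : ℝ) (z : ℂ) : ‖peak p e z‖ = (‖toHalfPlane p z + e‖ ^ 2)⁻¹ := by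
  rw [peak, norm_inv, norm_pow]

theorem norm_peak_le_of_le {p : ℂ} {e : ℝ} {z : ℂ} {t : ℝ} (ht : 0 < t)
    (h : t ≤ ‖toHalfPlane p z + e‖) : ‖peak p e z‖ ≤ (t ^ 2)⁻¹ := by
  rw [norm_peak]
  gcongr

theorem differentiableOn_peak {p : ℂ} (hp : ‖p‖ = 1) {e : ℝ} (he : 0 < e) :
    DifferentiableOn ℂ (peak p e) disc := by
  refine (((differentiable_toHalfPlane p).add_const _).pow 2).differentiableOn.inv fun z hz => ?_
  refine pow_ne_zero 2 (norm_pos_iff.1 ?_)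
  exact he.trans_le (le_norm_add (re_toHalfPlane_pos hp hz).le)

theorem integrableOn_peak {p : ℂ} (hp : ‖p‖ = 1) {e : ℝ} (he : 0 < e) :
    IntegrableOn (peak p e) disc volume := by
  refine Integrable.of_bound ((differentiableOn_peak hp he).continuousOn.aestronglyMeasurable
    measurableSet_disc) (e ^ 2)⁻¹ ?_
  filter_upwards [ae_mem_disc] with z hz
  exact norm_peak_le_of_le he (le_norm_add (re_toHalfPlane_pos hp hz).le)

/-- Were the integral finite, its parts over the discs of radius `t` internally tangent at `p` would
tend to `0`. Each is at least `π t² / (2 t)² = π / 4`. -/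
theorem lintegral_inv_sq_eq_top {p : ℂ} (hp : ‖p‖ = 1) :
    ∫⁻ z in disc, ENNReal.ofReal ((‖toHalfPlane p z‖ ^ 2)⁻¹) = ∞ := by
  by_contra hfin
  set t : ℕ → ℝ := fun k => 1 / ((k : ℝ) + 1) with ht
  have ht0 : ∀ k, 0 < t k := fun k => by positivity
  have htt : Tendsto t atTop (𝓝 0) := tendsto_one_div_add_atTop_nhds_zero_nat
  have ht1 : ∀ k, t k ≤ 1 := fun k => by
    simp only [ht]
    rw [div_le_one (by positivity)]
    linarith [Nat.cast_nonneg (α := ℝ) k]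
  set s : ℕ → Set ℂ := fun k => Metric.ball (((1 - t k : ℝ) : ℂ) * p) (t k) with hs
  have hcen : ∀ k, ‖((1 - t k : ℝ) : ℂ) * p‖ = 1 - t k := fun k => by
    rw [norm_mul, hp, mul_one, Complex.norm_real, Real.norm_of_nonneg (by linarith [ht1 k])]
  have hsub : ∀ k, s k ⊆ disc := fun k => by
    refine Metric.ball_subset_ball' ?_
    rw [dist_zero_right, hcen]
    linarith
  have hvol : ∀ k, volume (s k) = ENNReal.ofReal (t k ^ 2 * Real.pi) := fun k => by
    rw [hs, Complex.volume_ball, ← ENNReal.ofReal_coe_nnreal, ← ENNReal.ofReal_pow (ht0 k).le,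
      ← ENNReal.ofReal_mul (by positivity), NNReal.coe_real_pi]
  have hres : ∀ k, ((volume : Measure ℂ).restrict disc).restrict (s k) = volume.restrict (s k) :=
    fun k => by
      rw [Measure.restrict_restrict Metric.isOpen_ball.measurableSet,
        Set.inter_eq_left.2 (hsub k)]
  have hzero := tendsto_setLIntegral_zero hfin (s := s) (l := atTop) (by
    have h1 : Tendsto (fun k => ENNReal.ofReal (t k ^ 2 * Real.pi)) atTop (𝓝 0) := by
      have := ENNReal.tendsto_ofReal ((htt.pow 2).mul_const Real.pi)
      simpa using this
    refine h1.congr fun k => ?_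
    rw [Function.comp_apply, Measure.restrict_apply Metric.isOpen_ball.measurableSet,
      Set.inter_eq_left.2 (hsub k), hvol])
  have hlow : ∀ k, ENNReal.ofReal (Real.pi / 4) ≤
      ∫⁻ z in s k, ENNReal.ofReal ((‖toHalfPlane p z‖ ^ 2)⁻¹)
        ∂((volume : Measure ℂ).restrict disc) := by
    intro k
    have htk := ht0 k
    rw [hres]
    calc ENNReal.ofReal (Real.pi / 4)
        = ∫⁻ z in s k, ENNReal.ofReal (((2 * t k) ^ 2)⁻¹) := by
          rw [setLIntegral_const, hvol, ← ENNReal.ofReal_mul (by positivity)]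
          congr 1
          field_simp
          norm_num
      _ ≤ _ := by
          refine setLIntegral_mono' Metric.isOpen_ball.measurableSet fun z hz => ?_
          have h1 : 0 < ‖toHalfPlane p z‖ :=
            (re_toHalfPlane_pos hp (hsub k hz)).trans_le (Complex.re_le_norm _)
          refine ENNReal.ofReal_le_ofReal ?_
          have h2 : ‖toHalfPlane p z‖ ≤ 2 * t k := by
            rw [norm_toHalfPlane hp]
            have h3 : ‖z - ((1 - t k : ℝ) : ℂ) * p‖ < t k := mem_ball_iff_norm.1 hz
            have h4 : z - p = (z - ((1 - t k : ℝ) : ℂ) * p) + -((t k : ℂ) * p) := by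
              push_cast
              ring
            rw [h4]
            refine (norm_add_le _ _).trans ?_
            rw [norm_neg, norm_mul, hp, Complex.norm_real, Real.norm_of_nonneg htk.le]
            linarith
          gcongr
  have h5 := ge_of_tendsto hzero (Eventually.of_forall hlow)
  rw [nonpos_iff_eq_zero, ENNReal.ofReal_eq_zero] at h5
  linarith [Real.pi_pos]

/-- Monotone convergence: as `Re w > 0` for `w = toHalfPlane p z`, the modulus `|w + e|` decreases
with `e`, so the peaks grow to `|w|⁻²`, whose integral is infinite. -/
theorem tendsto_integral_norm_peak {p : ℂ} (hp : ‖p‖ = 1) :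
    Tendsto (fun n : ℕ => ∫ z in disc, ‖peak p (1 / ((n : ℝ) + 1)) z‖) atTop atTop := by
  have hpos : ∀ n : ℕ, (0 : ℝ) < 1 / ((n : ℝ) + 1) := fun n => by positivity
  have hanti : Antitone fun n : ℕ => 1 / ((n : ℝ) + 1) := fun m n h => Nat.one_div_le_one_div h
  have h : Tendsto (fun n : ℕ => ∫⁻ z in disc,
      ENNReal.ofReal (‖peak p (1 / ((n : ℝ) + 1)) z‖)) atTop
      (𝓝 (∫⁻ z in disc, ENNReal.ofReal ((‖toHalfPlane p z‖ ^ 2)⁻¹))) := by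
    refine lintegral_tendsto_of_tendsto_of_monotone (fun n => ?_) ?_ ?_
    · exact (integrableOn_peak hp (hpos n)).aestronglyMeasurable.aemeasurable.norm.ennreal_ofReal
    · filter_upwards [ae_mem_disc] with z hz m n hmn
      have hre := (re_toHalfPlane_pos hp hz).le
      refine ENNReal.ofReal_le_ofReal ?_
      rw [norm_peak p (1 / ((n : ℝ) + 1)), norm_peak]
      have h0 := (hpos n).trans_le (le_norm_add hre)
      refine inv_anti₀ (by positivity) (pow_le_pow_left₀ h0.le ?_ 2)
      have h1 := norm_le_norm_add (w := toHalfPlane p z + (1 / ((n : ℝ) + 1) : ℝ))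
        (e := 1 / ((m : ℝ) + 1) - 1 / ((n : ℝ) + 1)) (by
          rw [Complex.add_re, Complex.ofReal_re]
          linarith [hpos n]) (sub_nonneg.2 (hanti hmn))
      rwa [add_assoc, ← Complex.ofReal_add, add_sub_cancel] at h1
    · filter_upwards [ae_mem_disc] with z hz
      have hre := re_toHalfPlane_pos hp hz
      have hne : ‖toHalfPlane p z‖ ^ 2 ≠ 0 :=
        pow_ne_zero 2 (hre.trans_le (Complex.re_le_norm _)).ne'
      refine ENNReal.tendsto_ofReal ?_
      simp_rw [norm_peak]
      refine Tendsto.inv₀ ?_ hne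
      have h1 : Tendsto (fun n : ℕ => ((1 / ((n : ℝ) + 1) : ℝ) : ℂ)) atTop (𝓝 ((0 : ℝ) : ℂ)) :=
        (Complex.continuous_ofReal.tendsto 0).comp tendsto_one_div_add_atTop_nhds_zero_nat
      have h2 := ((h1.const_add (toHalfPlane p z)).norm).pow 2
      rwa [Complex.ofReal_zero, add_zero] at h2
  rw [lintegral_inv_sq_eq_top hp] at h
  rw [← ENNReal.tendsto_ofReal_nhds_top]
  refine h.congr fun n => ?_
  rw [ofReal_integral_eq_lintegral_ofReal (integrableOn_peak hp (hpos n)).norm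
    (Eventually.of_forall fun _ => norm_nonneg _)]

end Peak

/-! ### A perturbation at `p` whose class is nonzero. -/

section NonzeroPerturbation

/-- A continuous cutoff function that is `1` near `p` and vanishes off the disc of radius `η`. -/
def cutoff (p : ℂ) (η : ℝ) (z : ℂ) : ℝ := max 0 (min 1 (2 - 2 * ‖z - p‖ / η))

theorem continuous_cutoff (p : ℂ) (η : ℝ) : Continuous (cutoff p η) := by
  unfold cutoff
  fun_prop

theorem cutoff_nonneg (p : ℂ) (η : ℝ) (z : ℂ) : 0 ≤ cutoff p η z := le_max_left _ _

theorem cutoff_le_one (p : ℂ) (η : ℝ) (z : ℂ) : cutoff p η z ≤ 1 :=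
  max_le zero_le_one (min_le_left _ _)

theorem cutoff_eq_one {p : ℂ} {η : ℝ} (hη : 0 < η) {z : ℂ} (hz : ‖z - p‖ ≤ η / 2) :
    cutoff p η z = 1 := by
  have : 2 * ‖z - p‖ / η ≤ 1 := by
    rw [div_le_one hη]
    linarith
  rw [cutoff, min_eq_left (by linarith), max_eq_right zero_le_one]

theorem mem_ball_of_cutoff_ne_zero {p : ℂ} {η : ℝ} (hη : 0 < η) {z : ℂ} (hz : cutoff p η z ≠ 0) :
    z ∈ Metric.ball p η := by
  rw [mem_ball_iff_norm]
  by_contra! h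
  refine hz (max_eq_left ((min_le_right _ _).trans ?_))
  have : 2 ≤ 2 * ‖z - p‖ / η := by
    rw [le_div_iff₀ hη]
    linarith
  linarith

/-- The phase of the inverse of the limit of the peak functions at `p`. -/
def peakPhase (p z : ℂ) : ℂ := toHalfPlane p z ^ 2 / (‖toHalfPlane p z‖ : ℂ) ^ 2

theorem norm_peakPhase_le (p z : ℂ) : ‖peakPhase p z‖ ≤ 1 := by
  rw [peakPhase, norm_div, norm_pow, norm_pow, Complex.norm_real, norm_norm]
  exact div_self_le_one _

/-- The phases agree well where `9 e ≤ |z - p| ≤ η / 2`. Elsewhere only the lower bound `-|peak|` is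
used, and a correction of `3/2 |peak|` makes up the difference, with `|peak| ≤ (η / 2)⁻²` far from
`p` and `|peak| ≤ e⁻²` close to it. -/
theorem re_cutoff_mul_peak_ge {p : ℂ} (hp : ‖p‖ = 1) {η e : ℝ} (hη : 0 < η) (he : 0 < e) {z : ℂ}
    (hz : z ∈ disc) :
    1 / 2 * ‖peak p e z‖ - 3 / 2 * ((η / 2) ^ 2)⁻¹
        - (Metric.ball p (9 * e)).indicator (fun _ => 3 / 2 * (e ^ 2)⁻¹) z
      ≤ (((cutoff p η z : ℝ) : ℂ) * peakPhase p z * peak p e z).re := by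
  have hre := re_toHalfPlane_pos hp hz
  have hi : 0 ≤ (Metric.ball p (9 * e)).indicator (fun _ => 3 / 2 * (e ^ 2)⁻¹) z :=
    Set.indicator_nonneg (fun _ _ => by positivity) z
  have hη2 : 0 ≤ 3 / 2 * ((η / 2) ^ 2)⁻¹ := by positivity
  have htriv : -‖peak p e z‖ ≤ (((cutoff p η z : ℝ) : ℂ) * peakPhase p z * peak p e z).re := by
    refine le_trans (neg_le_neg ?_) (neg_le_of_abs_le (Complex.abs_re_le_norm _))
    rw [norm_mul, norm_mul, Complex.norm_real, Real.norm_of_nonneg (cutoff_nonneg _ _ _)]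
    refine mul_le_of_le_one_left (norm_nonneg _) ?_
    exact mul_le_one₀ (cutoff_le_one _ _ _) (norm_nonneg _) (norm_peakPhase_le _ _)
  rcases le_total (η / 2) ‖toHalfPlane p z‖ with h1 | h1
  · have := norm_peak_le_of_le (p := p) (half_pos hη) (h1.trans (norm_le_norm_add hre.le he.le))
    linarith
  · by_cases h2 : z ∈ Metric.ball p (9 * e)
    · have := norm_peak_le_of_le (p := p) he (le_norm_add hre.le)
      rw [Set.indicator_of_mem h2]
      linarith
    · rw [norm_toHalfPlane hp] at h1
      rw [mem_ball_iff_norm, not_lt, ← norm_toHalfPlane hp] at h2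
      have h3 := half_le_re_peak hre he h2
      rw [← norm_peak] at h3
      rw [cutoff_eq_one hη h1, Complex.ofReal_one, one_mul]
      refine le_trans ?_ h3
      linarith

theorem exists_re_pairing_peak_ge {p : ℂ} (hp : ‖p‖ = 1) {η δ : ℝ} (hη : 0 < η) (hδ : 0 < δ)
    {h : Bel} (hh : h =ᵐ[(volume : Measure ℂ).restrict disc]
      fun z => (δ : ℂ) * (((cutoff p η z : ℝ) : ℂ) * peakPhase p z)) :
    ∃ C, ∀ e > 0, δ * (1 / 2 * (∫ z in disc, ‖peak p e z‖) - C) ≤ (pairing h (peak p e)).re := by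
  -- The constant is independent of `e`: the ball of radius `9 e` has area `81 π e²`, cancelling
  -- `e⁻²`.
  refine ⟨3 / 2 * ((η / 2) ^ 2)⁻¹ * Real.pi + 3 / 2 * 81 * Real.pi, fun e he => ?_⟩
  have hm : MeasurableSet (Metric.ball p (9 * e)) := Metric.isOpen_ball.measurableSet
  have i0 := integrableOn_peak hp he
  have i1 := integrable_bel_mul h i0
  have i2 : Integrable ((Metric.ball p (9 * e)).indicator fun _ => 3 / 2 * (e ^ 2)⁻¹)
      ((volume : Measure ℂ).restrict disc) := (integrable_const _).indicator hm
  have i3 : Integrable (fun z => 1 / 2 * ‖peak p e z‖ - 3 / 2 * ((η / 2) ^ 2)⁻¹)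
      ((volume : Measure ℂ).restrict disc) := (i0.norm.const_mul _).sub (integrable_const _)
  have hvol : ((volume : Measure ℂ).restrict disc).real (Metric.ball p (9 * e))
      ≤ 81 * e ^ 2 * Real.pi := by
    have h1 : ((volume : Measure ℂ).restrict disc).real (Metric.ball p (9 * e))
        ≤ (volume : Measure ℂ).real (Metric.ball p (9 * e)) :=
      ENNReal.toReal_mono measure_ball_lt_top.ne (Measure.restrict_apply_le _ _)
    refine h1.trans_eq ?_
    rw [Measure.real, Complex.volume_ball, ENNReal.toReal_mul, ENNReal.toReal_pow,
      ENNReal.toReal_ofReal (by positivity), ENNReal.coe_toReal, NNReal.coe_real_pi]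
    ring
  have hre : (pairing h (peak p e)).re = ∫ z in disc, (h z * peak p e z).re :=
    (Complex.reCLM.integral_comp_comm i1).symm
  rw [hre]
  calc δ * (1 / 2 * (∫ z in disc, ‖peak p e z‖)
        - (3 / 2 * ((η / 2) ^ 2)⁻¹ * Real.pi + 3 / 2 * 81 * Real.pi))
      ≤ δ * (1 / 2 * (∫ z in disc, ‖peak p e z‖) - Real.pi * (3 / 2 * ((η / 2) ^ 2)⁻¹)
        - ((volume : Measure ℂ).restrict disc).real (Metric.ball p (9 * e))
          * (3 / 2 * (e ^ 2)⁻¹)) := by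
        refine mul_le_mul_of_nonneg_left ?_ hδ.le
        have h2 : ((volume : Measure ℂ).restrict disc).real (Metric.ball p (9 * e))
            * (3 / 2 * (e ^ 2)⁻¹) ≤ 81 * e ^ 2 * Real.pi * (3 / 2 * (e ^ 2)⁻¹) := by
          gcongr
        have h3 : 81 * e ^ 2 * Real.pi * (3 / 2 * (e ^ 2)⁻¹) = 3 / 2 * 81 * Real.pi := by
          field_simp
        linarith
    _ = ∫ z in disc, δ * (1 / 2 * ‖peak p e z‖ - 3 / 2 * ((η / 2) ^ 2)⁻¹
        - (Metric.ball p (9 * e)).indicator (fun _ => 3 / 2 * (e ^ 2)⁻¹) z) := by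
        rw [integral_const_mul, integral_sub i3 i2,
          integral_sub (i0.norm.const_mul _) (integrable_const _), integral_const_mul,
          integral_const, volume_real_disc, integral_indicator hm, setIntegral_const,
          smul_eq_mul, smul_eq_mul]
    _ ≤ ∫ z in disc, (h z * peak p e z).re := by
        refine integral_mono_ae ((i3.sub i2).const_mul δ) (Complex.reCLM.integrable_comp i1) ?_
        filter_upwards [ae_mem_disc, hh] with z hz hz2
        rw [hz2, mul_assoc (δ : ℂ), Complex.re_ofReal_mul]
        exact mul_le_mul_of_nonneg_left (re_cutoff_mul_peak_ge hp hη he hz) hδ.le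

theorem isDegenerating_peak {p : ℂ} (hp : ‖p‖ = 1) {e : ℕ → ℝ} (he : ∀ n, 0 < e n)
    (hN : ∀ n, 0 < ∫ z in disc, ‖peak p (e n) z‖)
    (hlim : Tendsto (fun n => ∫ z in disc, ‖peak p (e n) z‖) atTop atTop) :
    IsDegenerating fun n z => (((∫ z in disc, ‖peak p (e n) z‖)⁻¹ : ℝ) : ℂ) * peak p (e n) z := by
  have hnorm : ∀ n z, ‖(((∫ z in disc, ‖peak p (e n) z‖)⁻¹ : ℝ) : ℂ) * peak p (e n) z‖
      = (∫ z in disc, ‖peak p (e n) z‖)⁻¹ * ‖peak p (e n) z‖ := fun n z => by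
    rw [norm_mul, Complex.norm_real, Real.norm_of_nonneg (inv_nonneg.2 (hN n).le)]
  have hone : ∀ n, ∫ z in disc,
      ‖(((∫ z in disc, ‖peak p (e n) z‖)⁻¹ : ℝ) : ℂ) * peak p (e n) z‖ = 1 := fun n => by
    simp_rw [hnorm]
    rw [integral_const_mul, inv_mul_cancel₀ (hN n).ne']
  refine IsLocallyNull.isDegenerating ⟨fun n => (differentiableOn_peak hp (he n)).const_mul _,
    fun n => (integrableOn_peak hp (he n)).const_mul _, ⟨1, fun n => (hone n).le⟩, ?_⟩ hone
  intro ρ hρ ε hε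
  -- On `|z| ≤ ρ` the peaks stay below `(1 - ρ)⁻²`, while their total masses diverge.
  filter_upwards [hlim.eventually_ge_atTop (((1 - ρ) ^ 2)⁻¹ / ε)] with n hn z hz
  rw [hnorm, ← div_eq_inv_mul, div_le_iff₀ (hN n)]
  have h1 := one_sub_norm_le_re_toHalfPlane hp z
  have h2 : 1 - ρ ≤ ‖toHalfPlane p z + e n‖ :=
    le_trans (by linarith [Complex.re_le_norm (toHalfPlane p z)])
      (norm_le_norm_add (by linarith) (he n).le)
  refine (norm_peak_le_of_le (by linarith) h2).trans ?_
  rw [div_le_iff₀ hε] at hn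
  linarith

theorem degSup_pos_of_peakPhase {p : ℂ} (hp : ‖p‖ = 1) {η δ : ℝ} (hη : 0 < η) (hδ : 0 < δ)
    {h : Bel} (hh : h =ᵐ[(volume : Measure ℂ).restrict disc]
      fun z => (δ : ℂ) * (((cutoff p η z : ℝ) : ℂ) * peakPhase p z)) : 0 < degSup h := by
  obtain ⟨C, hC⟩ := exists_re_pairing_peak_ge hp hη hδ hh
  -- Once the mass `N` is at least `4 C`, one has `N / 2 - C ≥ N / 4`, so the normalised pairings
  -- are at least `δ / 4`.
  obtain ⟨k, hk⟩ := eventually_atTop.1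
    ((tendsto_integral_norm_peak hp).eventually_ge_atTop (max 1 (4 * C)))
  set e : ℕ → ℝ := fun n => 1 / (((n + k : ℕ) : ℝ) + 1) with he
  have he0 : ∀ n, 0 < e n := fun n => by positivity
  have hN : ∀ n, max 1 (4 * C) ≤ ∫ z in disc, ‖peak p (e n) z‖ := fun n =>
    hk (n + k) (Nat.le_add_left _ _)
  have hN0 : ∀ n, 0 < ∫ z in disc, ‖peak p (e n) z‖ := fun n =>
    (lt_max_of_lt_left one_pos).trans_le (hN n)
  have hdeg := isDegenerating_peak hp he0 hN0
    ((tendsto_integral_norm_peak hp).comp (tendsto_add_atTop_nat k))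
  have h1 : δ / 4 ≤ limsup (fun n => ‖pairing h fun z =>
      (((∫ z in disc, ‖peak p (e n) z‖)⁻¹ : ℝ) : ℂ) * peak p (e n) z‖) atTop := by
    refine le_limsup_of_frequently_le (Frequently.of_forall fun n => ?_)
      (isBoundedUnder_le h hdeg)
    rw [pairing_const_smul, norm_mul, Complex.norm_real,
      Real.norm_of_nonneg (inv_nonneg.2 (hN0 n).le), ← div_eq_inv_mul, le_div_iff₀ (hN0 n)]
    refine le_trans ?_ ((hC (e n) (he0 n)).trans (Complex.re_le_norm _))
    have h2 := (le_max_right _ _).trans (hN n)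
    nlinarith
  exact (by positivity : 0 < δ / 4).trans_le (h1.trans (limsup_le_degSup h hdeg))

/-- Non-substantial classes are not extreme points of the ball through them. -/
theorem exists_perturbation {x : AZ} (hx : ¬ IsSubstantialPoint x) :
    x ≠ 0 ∧ ∃ h : AZ, h ≠ 0 ∧ ‖x + h‖ ≤ ‖x‖ ∧ ‖x - h‖ ≤ ‖x‖ := by
  obtain ⟨p, hp, ν, rfl, c, hc0, hc, η, hη, hν⟩ := exists_small_representative hx
  rw [AZ.norm_mk] at hc
  have hδ : 0 < degSup ν - c := sub_pos.2 hc
  refine ⟨fun h0 => ?_, ?_⟩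
  · have h1 := AZ.norm_mk ν
    rw [h0, norm_zero] at h1
    linarith
  -- The modulus is bounded by the slack `(‖x‖ - c) f` left by `ν`, and the phase is opposite to
  -- that of the peaks.
  set g : ℂ → ℂ := fun z =>
    ((degSup ν - c : ℝ) : ℂ) * (((cutoff p η z : ℝ) : ℂ) * peakPhase p z) with hg
  have hgb : ∀ z, ‖g z‖ ≤ (degSup ν - c) * cutoff p η z := fun z => by
    rw [hg]
    simp only [norm_mul, Complex.norm_real, Real.norm_of_nonneg hδ.le,
      Real.norm_of_nonneg (cutoff_nonneg p η z)]
    exact mul_le_mul_of_nonneg_left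
      (mul_le_of_le_one_right (cutoff_nonneg p η z) (norm_peakPhase_le p z)) hδ.le
  have hgm : Measurable g := by
    have h1 := (differentiable_toHalfPlane p).continuous.measurable
    have h2 := (continuous_cutoff p η).measurable
    simp only [hg, peakPhase]
    fun_prop
  obtain ⟨h, hh⟩ := exists_bel hgm.aestronglyMeasurable (C := degSup ν - c)
    (Eventually.of_forall fun z => (hgb z).trans
      (mul_le_of_le_one_right hδ.le (cutoff_le_one p η z)))
  have hsupp : ∀ᵐ z ∂((volume : Measure ℂ).restrict disc), cutoff p η z ≠ 0 → ‖ν z‖ ≤ c := by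
    filter_upwards [hν] with z hz hz0
    exact hz (mem_ball_of_cutoff_ne_zero hη hz0)
  refine ⟨AZ.mk h, fun h0 => ?_, ?_, ?_⟩
  · have h1 := degSup_pos_of_peakPhase hp hη hδ hh
    rw [← AZ.norm_mk, h0, norm_zero] at h1
    exact lt_irrefl _ h1
  · rw [← map_add, AZ.norm_mk, AZ.norm_mk]
    refine degSup_add_le_of_small_support (continuous_cutoff p η) (cutoff_nonneg p η)
      (cutoff_le_one p η) hsupp ?_
    filter_upwards [hh] with z hz
    rw [hz]
    exact hgb z
  · rw [← map_sub, AZ.norm_mk, AZ.norm_mk, sub_eq_add_neg]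
    refine degSup_add_le_of_small_support (continuous_cutoff p η) (cutoff_nonneg p η)
      (cutoff_le_one p η) hsupp ?_
    filter_upwards [hh, Lp.coeFn_neg h] with z hz hz2
    rw [hz2, Pi.neg_apply, norm_neg, hz]
    exact hgb z

end NonzeroPerturbation

end AsymptoticTangent

end

theorem theorem8p1 (x : AsymptoticTangent.AZ)
    (hx : ¬ AsymptoticTangent.IsSubstantialPoint x) :
    {G : Set AsymptoticTangent.AZ |
      AsymptoticTangent.IsGeodesicJoining G x 0}.Infinite := by
  obtain ⟨hx0, h, hh, hadd, hsub⟩ := AsymptoticTangent.exists_perturbation hx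
  exact AsymptoticTangent.infinite_isGeodesicJoining hx0 hh hadd hsub
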